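/- Let $m\ge 1$, $0<q<1$, $R>0$, and let $\mathbb{R}_{0,m}$ be the real Clifford algebra with generators $e_1,\dots,e_m$ and relations $e_ie_j+e_je_i=-2\delta_{ij}$. Write $\underline{x}=\sum_j e_jx_j$ (so $\underline{x}^2=-|x|^2$ and $1/\underline{x}=-\underline{x}/|x|^2$), let $\mathbb{B}^m(R)$ be the closed ball of radius $R$ in $\mathbb{R}^m$, $\mathbb{E}=\sum_j x_j\partial_{x_j}$ the Euler operator and $\Gamma=-\sum_{i<j}e_ie_j(x_i\partial_{x_j}-x_j\partial_{x_i})$. Put $(q^{\mathbb{E}}f)(\underline{x})=f(q\underline{x})$ and $(q^{\Gamma}f)(\underline{x})=G(\ln q,\underline{x})$, where $G$ is the analytic solution of $\partial_uG=\Gamma G$, $G(0,\cdot)=f$, for $u\in[\ln q,0]$, when this solution exists. The $q$-Dirac operator and the $q$-Laplace operator are $$\partial^q_{\underline{x}}f=\frac1{\underline{x}}[\mathbb{E}+\Gamma]_qf=\frac{1}{\underline{x}}\,\frac{(q^\Gamma f)(q\underline{x})-f(\underline{x})}{q-1},\qquad \Delta_q=-(\partial^q_{\underline{x}})^2$$ (at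 the origin $\partial^q_{\underline{x}}f$ is defined by its limit). For a Clifford-valued function $h$ on $\mathbb{B}^m(R)$ the $q$-integral is $$\int_{\mathbb{B}^m(R)}h\,d_qV=\int_{\mathbb{S}^{m-1}}d\xi\int_0^R d_qr\,r^{m-1}h(r\xi),\qquad \int_0^R\varphi(r)\,d_qr=(1-q)R\sum_{k=0}^\infty\varphi(Rq^k)q^k,$$ with $d\xi$ the surface measure of the unit sphere. Let $f$ and $g$ be two $\mathbb{R}_{0,m}$-valued functions, real analytic on $\mathbb{B}^m(R)$, for which $\Delta_qf$ and $\Delta_qg$ are defined on $\mathbb{B}^m(R)$ (that is, for $h=f,g$ the functions $q^\Gamma h$ and $q^\Gamma\partial^q_{\underline{x}}h$ exist, in the above sense, on $\mathbb{B}^m(qR)$). If $g=0=\partial^q_{\underline{x}}g$ on the sphere $\partial\mathbb{B}^m(R)$, then both of the following $q$-integrals converge and $$\int_{\mathbb{B}^m(R)}f(q\underline{x})\,(\Delta_qg)(\underline{x})\,d_qV(\underline{x})=\int_{\mathbb{B}^m(R)}(\Delta_qf)(\underline{x})\,g(q\underline{x})\,d_qV(\underline{x}).$$ -/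

import Mathlib

namespace QClifford

open Filter Topology MeasureTheory

/-- The vector space `ℝ^m` with its Euclidean norm. -/
abbrev Vec (m : ℕ) : Type := EuclideanSpace ℝ (Fin m)

/-- The negative definite quadratic form `-(x_1^2 + ... + x_m^2)`. -/
noncomputable def negForm (m : ℕ) : QuadraticForm ℝ (Fin m → ℝ) :=
  QuadraticMap.weightedSumSquares ℝ (fun _ : Fin m => (-1 : ℝ))

/-- The real Clifford algebra `ℝ_{0,m}`, with `e_i e_j + e_j e_i = -2 δ_{ij}`. -/
abbrev Cl (m : ℕ) : Type := CliffordAlgebra (negForm m)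

/-- The generator `e_j`. -/
noncomputable def e {m : ℕ} (j : Fin m) : Cl m :=
  CliffordAlgebra.ι (negForm m) (Pi.single j 1)

theorem e_mul_e_add {m : ℕ} (i j : Fin m) :
    e i * e j + e j * e i = algebraMap ℝ (Cl m) (if i = j then -2 else 0) := by
  rw [e, e, CliffordAlgebra.ι_mul_ι_add_swap]
  congr 1
  simp only [QuadraticMap.polar, negForm, QuadraticMap.weightedSumSquares_apply, Pi.add_apply,
    smul_eq_mul, ← Finset.sum_sub_distrib]
  rcases eq_or_ne i j with rfl | h
  · rw [Finset.sum_eq_single i]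
    · norm_num
    · intro b _ hb
      simp [hb]
    · simp
  · rw [if_neg h]
    apply Finset.sum_eq_zero
    intro b _
    by_cases hb : b = i
    · subst hb
      simp [h]
    · simp [hb]

/-- The linear basis of the Clifford algebra indexed by the subsets of `{1, ..., m}`
(the products of generators). -/
noncomputable def clBasis (m : ℕ) : Module.Basis (Finset (Fin m)) ℝ (Cl m) :=
  letI : Invertible (2 : ℝ) := invertibleOfNonzero two_ne_zero
  (Pi.basisFun ℝ (Fin m)).ExteriorAlgebra.map (CliffordAlgebra.equivExterior (negForm m)).symm

/-- Coordinates with respect to `clBasis`, with Euclidean target. -/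
noncomputable def clCoord (m : ℕ) : Cl m ≃ₗ[ℝ] EuclideanSpace ℝ (Finset (Fin m)) :=
  (clBasis m).equivFun.trans (WithLp.linearEquiv 2 ℝ (Finset (Fin m) → ℝ)).symm

/-- The Clifford norm: the Euclidean norm of the `2^m` real coordinates.  It only serves to speak
of analyticity, derivatives, series and integrals in this finite-dimensional real vector space. -/
noncomputable instance instNormedAddCommGroupCl (m : ℕ) : NormedAddCommGroup (Cl m) :=
  NormedAddCommGroup.induced (Cl m) (EuclideanSpace ℝ (Finset (Fin m))) (clCoord m)
    (clCoord m).injective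

noncomputable instance instNormedSpaceCl (m : ℕ) : NormedSpace ℝ (Cl m) :=
  NormedSpace.induced ℝ (Cl m) (EuclideanSpace ℝ (Finset (Fin m))) (clCoord m)

variable {m : ℕ}

/-- The vector variable `x = ∑ e_j x_j`; it satisfies `x * x = -|x|^2`. -/
noncomputable def vec (x : Vec m) : Cl m := ∑ j : Fin m, x j • e j

/-- The inverse `1/x = -x/|x|^2` of the vector variable (`x ≠ 0`). -/
noncomputable def vecInv (x : Vec m) : Cl m := -((‖x‖ ^ 2)⁻¹ • vec x)

/-- The partial derivative with respect to `x_j`. -/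
noncomputable def partialDeriv (j : Fin m) (f : Vec m → Cl m) (x : Vec m) : Cl m :=
  fderiv ℝ f x (EuclideanSpace.single j 1)

/-- The Gamma operator `Γ = -∑_{i<j} e_i e_j (x_i ∂_{x_j} - x_j ∂_{x_i})`. -/
noncomputable def Gamma (f : Vec m → Cl m) (x : Vec m) : Cl m :=
  -∑ i : Fin m, ∑ j : Fin m,
    if i < j then e i * e j * (x i • partialDeriv j f x - x j • partialDeriv i f x) else 0

/-- `G` is an analytic solution, on the closed ball of radius `ρ` and for times `u` between
`ln q` and `0`, of the Cauchy problem `∂_u G = Γ G`, `G(0, x) = f x`; in other words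
`G(u, x) = (exp (u Γ) f)(x)`.  (Here `0 < q < 1`.) -/
def IsGammaFlow (q ρ : ℝ) (f : Vec m → Cl m) (G : ℝ → Vec m → Cl m) : Prop :=
  AnalyticOnNhd ℝ (fun p : ℝ × Vec m => G p.1 p.2)
      (Set.Icc (Real.log q) 0 ×ˢ Metric.closedBall 0 ρ) ∧
    (∀ u ∈ Set.Icc (Real.log q) 0, ∀ x ∈ Metric.closedBall (0 : Vec m) ρ,
      HasDerivAt (fun v => G v x) (Gamma (G u) x) u) ∧
    ∀ x ∈ Metric.closedBall (0 : Vec m) ρ, G 0 x = f x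

/-- `q^Γ f` is defined on the closed ball of radius `ρ`. -/
def QGammaDefined (q ρ : ℝ) (f : Vec m → Cl m) : Prop :=
  ∃ G : ℝ → Vec m → Cl m, IsGammaFlow q ρ f G

open Classical in
/-- The function `q^Γ f` on the closed ball of radius `ρ`: the value at time `u = ln q` of the
(unique) solution of the Cauchy problem.  Junk value `0` if there is no solution. -/
noncomputable def qGamma (q ρ : ℝ) (f : Vec m → Cl m) : Vec m → Cl m :=
  if h : QGammaDefined q ρ f then h.choose (Real.log q) else 0

/-- `[E + Γ]_q f = (q^E q^Γ f - f) / (q - 1)` on the closed ball of radius `R`, with `E` the Euler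
operator, for which `(q^E h)(x) = h(q x)`; only `q^Γ f` on the ball of radius `q R` is used. -/
noncomputable def qEulerGamma (q R : ℝ) (f : Vec m → Cl m) (x : Vec m) : Cl m :=
  (q - 1)⁻¹ • (qGamma q (q * R) f (q • x) - f x)

/-- The `q`-Dirac operator `∂^q f = (1/x) [E + Γ]_q f` on the closed ball of radius `R`; its value
at the origin, where `1/x` makes no sense, is the limit. -/
noncomputable def qDirac (q R : ℝ) (f : Vec m → Cl m) (x : Vec m) : Cl m :=
  open Classical in
  if x = 0 then limUnder (𝓝[≠] (0 : Vec m)) (fun y => vecInv y * qEulerGamma q R f y)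
  else vecInv x * qEulerGamma q R f x

/-- The `q`-Laplace operator `Δ_q = -(∂^q)^2` on the closed ball of radius `R`. -/
noncomputable def qLaplace (q R : ℝ) (f : Vec m → Cl m) (x : Vec m) : Cl m :=
  -qDirac q R (qDirac q R f) x

/-- `Δ_q f` is defined on the closed ball of radius `R`: both exponentials `q^Γ` that occur in
`∂^q ∂^q f` exist where they are used. -/
def QLaplaceDefined (q R : ℝ) (f : Vec m → Cl m) : Prop :=
  QGammaDefined q (q * R) f ∧ QGammaDefined q (q * R) (qDirac q R f)

/-- The one-dimensional `q`-integral
`∫_0^a h(t) d_q t = (1 - q) a ∑_{k ≥ 0} h(a q^k) q^k`. -/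
noncomputable def jackson (q a : ℝ) (h : ℝ → Cl m) : Cl m :=
  ((1 - q) * a) • ∑' k : ℕ, q ^ k • h (a * q ^ k)

/-- The `q`-integral of `f` over the ball of radius `R`:
`∫_{S^{m-1}} dξ ∫_0^R d_q r r^{m-1} f(r ξ)`, with `dξ` the surface measure of the unit sphere. -/
noncomputable def qIntegral (q R : ℝ) (f : Vec m → Cl m) : Cl m :=
  ∫ ξ : Metric.sphere (0 : Vec m) 1,
    jackson q R (fun r => r ^ (m - 1) • f (r • (ξ : Vec m))) ∂(volume : Measure (Vec m)).toSphere

/-- The expression defining the `q`-integral over the ball of radius `R` converges. -/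
def QIntegrable (q R : ℝ) (f : Vec m → Cl m) : Prop :=
  (∀ ξ : Metric.sphere (0 : Vec m) 1,
      Summable fun k : ℕ => q ^ k • ((R * q ^ k) ^ (m - 1) • f ((R * q ^ k) • (ξ : Vec m)))) ∧
    Integrable
      (fun ξ : Metric.sphere (0 : Vec m) 1 =>
        jackson q R (fun r => r ^ (m - 1) • f (r • (ξ : Vec m))))
      (volume : Measure (Vec m)).toSphere

end QClifford

/-! The proof reduces the theorem to a Green formula on each sphere of radius $r = Rq^k$ and then
sums a telescoping series.

Put $c = (m-2)/2$. The relation $\Gamma\underline{x} = \underline{x}(m-1-\Gamma)$ turns the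
existence of $q^\Gamma\partial^q f$ into the existence of $q^{-\Gamma}f$ (`reverseFlow`) and gives,
away from the origin (`qLaplace_eq`), $$(q-1)^2|x|^2\,\Delta_q f(x) = q^{m-2}f(q^2x) + f(x) -
\bigl((q^{\Gamma} + q^{m-2}q^{-\Gamma})f\bigr)(qx).$$ The last operator is $2q^c\cosh(\ln
q\,(\Gamma-c))$. It is even in $\Gamma-c$, so it depends only on $(\Gamma-c)^2 =
\Gamma^2-(m-2)\Gamma+c^2$. The part $\Gamma^2-(m-2)\Gamma$ is minus the spherical Laplacian: it acts
coordinatewise on Clifford values (`casimir_eq`) and is symmetric for $\int_{S_r} f g$ in spite of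
noncommutativity (`sphereIntegral_mul_casimir`). The hyperbolic cosine is handled without spectral
theory, as the solution operator of $\partial_u^2W = (\Gamma-c)^2W$ with $W_u(0)=0$. Its symmetry is
a Duhamel-type argument (`IsSphericalWave.sphereIntegral_eq`).

After integration over a sphere the middle terms for $f$ and $g$ cancel. With $d(x) =
f(x)g(qx)-f(qx)g(x)$, what remains is a multiple of $q^{m-2}\int_{S_{qr}}d - \int_{S_r}d$
(`sphereIntegral_green`). With the weights of the $q$-integral this telescopes in $J_k =
q^{(m-2)k}\int_{S_{Rq^k}}d$.

At the outer end $J_0=0$ requires $g=0$ on the spheres of radii $R$ and $qR$. The second follows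
because $g=\partial^q g=0$ at radius $R$ forces $q^\Gamma g=0$ at radius $qR$, and the flow of
$\Gamma$, a symmetric operator for a suitable inner product, has backward uniqueness
(`flow_backward_unique`). At the inner end $J_k\to0$ because $d(0)=0$ and the linear part of $d$ is
odd (`tendsto_boundary_term`). Convergence of the $q$-integrals follows from boundedness of
$\Delta_q f$ and $\Delta_q g$ on the punctured ball (`qLaplace_bounded`). -/

namespace QClifford

open Filter Topology MeasureTheory

/-! ### Integration over spheres -/

section Sphere

variable {m : ℕ} {F : Type*} [NormedAddCommGroup F] [NormedSpace ℝ F]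

/-- The restriction of a linear isometry to the unit sphere. -/
noncomputable def sphereMap (A : Vec m ≃ₗᵢ[ℝ] Vec m) (ξ : Metric.sphere (0 : Vec m) 1) :
    Metric.sphere (0 : Vec m) 1 :=
  ⟨A ξ, by simp⟩

theorem continuous_sphereMap (A : Vec m ≃ₗᵢ[ℝ] Vec m) : Continuous (sphereMap A) :=
  (A.continuous.comp continuous_subtype_val).subtype_mk _

-- The surface measure of a set is a multiple of the volume of the cone over it, and a linear
-- isometry preserves volume and maps cones to cones.
open scoped Pointwise in
theorem measurePreserving_sphereMap (A : Vec m ≃ₗᵢ[ℝ] Vec m) :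
    MeasurePreserving (sphereMap A) (volume : Measure (Vec m)).toSphere
      (volume : Measure (Vec m)).toSphere := by
  refine ⟨(continuous_sphereMap A).measurable, ?_⟩
  ext s hs
  have hpre := (continuous_sphereMap A).measurable hs
  rw [Measure.map_apply (continuous_sphereMap A).measurable hs, Measure.toSphere_apply' _ hs,
    Measure.toSphere_apply' _ hpre]
  congr 1
  have hset : Set.Ioo (0 : ℝ) 1 • ((↑) '' (sphereMap A ⁻¹' s) : Set (Vec m))
      = A ⁻¹' (Set.Ioo (0 : ℝ) 1 • ((↑) '' s : Set (Vec m))) := by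
    ext x
    simp only [Set.mem_smul, Set.mem_image, Set.mem_preimage]
    constructor
    · rintro ⟨t, ht, _, ⟨ξ, hξ, rfl⟩, rfl⟩
      exact ⟨t, ht, _, ⟨_, hξ, rfl⟩, by simp [sphereMap]⟩
    · rintro ⟨t, ht, _, ⟨ξ, hξ, rfl⟩, hx⟩
      refine ⟨t, ht, A.symm ξ, ⟨⟨A.symm ξ, by simp⟩, ?_, rfl⟩, ?_⟩
      · simpa [sphereMap] using hξ
      · rw [← map_smul, hx, A.symm_apply_apply]
  rw [hset]
  exact A.measurePreserving.measure_preimage_emb A.toMeasurableEquiv.measurableEmbedding _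

/-- The integral of `φ` over the sphere of radius `r`, with respect to the measure of the unit
sphere. -/
noncomputable def sphereIntegral (r : ℝ) (φ : Vec m → F) : F :=
  ∫ ξ : Metric.sphere (0 : Vec m) 1, φ (r • (ξ : Vec m)) ∂(volume : Measure (Vec m)).toSphere

theorem smul_mem_sphere {r : ℝ} (hr : 0 ≤ r) (ξ : Metric.sphere (0 : Vec m) 1) :
    r • (ξ : Vec m) ∈ Metric.sphere (0 : Vec m) r := by
  simp [norm_smul, abs_of_nonneg hr]

theorem continuous_smul_sphere {X : Type*} [TopologicalSpace X] {r : ℝ} (hr : 0 ≤ r)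
    {φ : Vec m → X} (hφ : ContinuousOn φ (Metric.sphere 0 r)) :
    Continuous fun ξ : Metric.sphere (0 : Vec m) 1 => φ (r • (ξ : Vec m)) :=
  hφ.comp_continuous (by fun_prop) (smul_mem_sphere hr)

theorem integrable_sphere {G : Type*} [NormedAddCommGroup G]
    {f : Metric.sphere (0 : Vec m) 1 → G} (hf : Continuous f) :
    Integrable f (volume : Measure (Vec m)).toSphere :=
  hf.integrable_of_hasCompactSupport (HasCompactSupport.of_compactSpace f)

theorem sphereIntegral_comp (A : Vec m ≃ₗᵢ[ℝ] Vec m) {r : ℝ} (hr : 0 ≤ r) {φ : Vec m → F}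
    (hφ : ContinuousOn φ (Metric.sphere 0 r)) :
    sphereIntegral r (fun x => φ (A x)) = sphereIntegral r φ := by
  have hc := continuous_smul_sphere hr hφ
  have h := (measurePreserving_sphereMap A).map_eq
  unfold sphereIntegral
  conv_rhs => rw [← h]
  rw [integral_map (continuous_sphereMap A).aemeasurable]
  · simp [sphereMap]
  · rw [h]
    exact hc.aestronglyMeasurable

theorem sphereIntegral_congr {r : ℝ} (hr : 0 ≤ r) {φ ψ : Vec m → F}
    (h : ∀ x ∈ Metric.sphere (0 : Vec m) r, φ x = ψ x) :
    sphereIntegral r φ = sphereIntegral r ψ := by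
  unfold sphereIntegral
  exact integral_congr_ae (.of_forall fun ξ => h _ (smul_mem_sphere hr ξ))

theorem sphereIntegral_add {r : ℝ} (hr : 0 ≤ r) {φ ψ : Vec m → F}
    (hφ : ContinuousOn φ (Metric.sphere 0 r)) (hψ : ContinuousOn ψ (Metric.sphere 0 r)) :
    sphereIntegral r (fun x => φ x + ψ x) = sphereIntegral r φ + sphereIntegral r ψ :=
  integral_add (integrable_sphere (continuous_smul_sphere hr hφ))
    (integrable_sphere (continuous_smul_sphere hr hψ))

theorem sphereIntegral_sub {r : ℝ} (hr : 0 ≤ r) {φ ψ : Vec m → F}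
    (hφ : ContinuousOn φ (Metric.sphere 0 r)) (hψ : ContinuousOn ψ (Metric.sphere 0 r)) :
    sphereIntegral r (fun x => φ x - ψ x) = sphereIntegral r φ - sphereIntegral r ψ :=
  integral_sub (integrable_sphere (continuous_smul_sphere hr hφ))
    (integrable_sphere (continuous_smul_sphere hr hψ))

theorem sphereIntegral_smul (r c : ℝ) (φ : Vec m → F) :
    sphereIntegral r (fun x => c • φ x) = c • sphereIntegral r φ :=
  integral_smul _ _

theorem sphereIntegral_finset_sum {ι : Type*} (s : Finset ι) {r : ℝ} (hr : 0 ≤ r)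
    {φ : ι → Vec m → F} (hφ : ∀ i ∈ s, ContinuousOn (φ i) (Metric.sphere 0 r)) :
    sphereIntegral r (fun x => ∑ i ∈ s, φ i x) = ∑ i ∈ s, sphereIntegral r (φ i) :=
  integral_finsetSum s fun i hi => integrable_sphere (continuous_smul_sphere hr (hφ i hi))

/-- The fundamental theorem of calculus for integrals over the sphere depending on a parameter. -/
theorem integral_sub_integral_eq_intervalIntegral_deriv [CompleteSpace F]
    {Φ Φ' : ℝ → Metric.sphere (0 : Vec m) 1 → F} {a b : ℝ}
    (hd : ∀ s ∈ Set.uIcc a b, ∀ ξ, HasDerivAt (fun s => Φ s ξ) (Φ' s ξ) s)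
    (hΦ : ∀ s ∈ Set.uIcc a b, Continuous (Φ s))
    (hc : ContinuousOn (Function.uncurry Φ') (Set.uIcc a b ×ˢ Set.univ)) :
    (∫ ξ, Φ b ξ ∂(volume : Measure (Vec m)).toSphere)
        - ∫ ξ, Φ a ξ ∂(volume : Measure (Vec m)).toSphere =
      ∫ s in a..b, ∫ ξ, Φ' s ξ ∂(volume : Measure (Vec m)).toSphere := by
  have hslice : ∀ ξ, ContinuousOn (fun s => Φ' s ξ) (Set.uIcc a b) := fun ξ =>
    hc.comp (f := fun s => (s, ξ)) (by fun_prop) fun s hs => ⟨hs, trivial⟩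
  have h1 : ∀ ξ, ∫ s in a..b, Φ' s ξ = Φ b ξ - Φ a ξ := fun ξ =>
    intervalIntegral.integral_eq_sub_of_hasDerivAt (fun s hs => hd s hs ξ)
      (hslice ξ).intervalIntegrable
  rw [← integral_sub (integrable_sphere (hΦ b Set.right_mem_uIcc))
    (integrable_sphere (hΦ a Set.left_mem_uIcc)), ← integral_congr_ae (.of_forall h1)]
  refine (intervalIntegral_integral_swap ?_).symm
  have hcomp : IsCompact (Set.uIcc a b ×ˢ (Set.univ : Set (Metric.sphere (0 : Vec m) 1))) :=
    isCompact_uIcc.prod isCompact_univ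
  have hi : IntegrableOn (Function.uncurry Φ')
      (Set.uIcc a b ×ˢ (Set.univ : Set (Metric.sphere (0 : Vec m) 1)))
      ((volume : Measure ℝ).prod (volume : Measure (Vec m)).toSphere) :=
    hc.integrableOn_compact hcomp
  have := hi.mono_set (Set.prod_mono Set.uIoc_subset_uIcc (Set.Subset.refl _))
  rwa [IntegrableOn, ← Measure.prod_restrict, Measure.restrict_univ] at this

end Sphere

/-! ### Plane rotations and angular derivatives -/

section Rotation

variable {m : ℕ} {F : Type*} [NormedAddCommGroup F] [NormedSpace ℝ F]

/-- The rotation by the angle `t` in the plane of the coordinates `i` and `j`. -/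
noncomputable def planeRotation (i j : Fin m) (hij : i ≠ j) (t : ℝ) : Vec m ≃ₗᵢ[ℝ] Vec m :=
  LinearIsometry.toLinearIsometryEquiv
    { toFun := fun x => x + ((Real.cos t - 1) * x i - Real.sin t * x j) • EuclideanSpace.single i 1
        + (Real.sin t * x i + (Real.cos t - 1) * x j) • EuclideanSpace.single j 1
      map_add' := fun x y => by
        simp only [PiLp.add_apply]
        module
      map_smul' := fun c x => by
        simp only [PiLp.smul_apply, smul_eq_mul, RingHom.id_apply]
        module
      norm_map' := fun x => by
        have h := Real.sin_sq_add_cos_sq t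
        rw [← sq_eq_sq₀ (norm_nonneg _) (norm_nonneg _)]
        simp only [LinearMap.coe_mk, AddHom.coe_mk]
        rw [norm_add_sq_real, norm_add_sq_real]
        simp only [norm_smul, PiLp.norm_single, inner_add_left, inner_smul_left,
          inner_smul_right, EuclideanSpace.inner_single_right, PiLp.single_apply, mul_pow,
          Real.norm_eq_abs, sq_abs]
        simp [hij.symm]
        linear_combination (x i ^ 2 + x j ^ 2) * h }
    rfl

theorem planeRotation_apply (i j : Fin m) (hij : i ≠ j) (t : ℝ) (x : Vec m) :
    planeRotation i j hij t x =
      x + ((Real.cos t - 1) * x i - Real.sin t * x j) • EuclideanSpace.single i 1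
        + (Real.sin t * x i + (Real.cos t - 1) * x j) • EuclideanSpace.single j 1 := rfl

theorem planeRotation_zero (i j : Fin m) (hij : i ≠ j) (x : Vec m) :
    planeRotation i j hij 0 x = x := by
  simp [planeRotation_apply]

/-- The generator `x_i ∂_{x_j} - x_j ∂_{x_i}` of the rotations in a coordinate plane. -/
noncomputable def angularDeriv (i j : Fin m) (f : Vec m → F) (x : Vec m) : F :=
  fderiv ℝ f x (x i • EuclideanSpace.single j 1 - x j • EuclideanSpace.single i 1)

theorem angularDeriv_self (i : Fin m) (f : Vec m → F) (x : Vec m) : angularDeriv i i f x = 0 := by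
  simp [angularDeriv]

theorem continuous_planeRotation (i j : Fin m) (hij : i ≠ j) :
    Continuous fun p : ℝ × Vec m => planeRotation i j hij p.1 p.2 := by
  simp only [planeRotation_apply]
  fun_prop

theorem hasDerivAt_planeRotation (i j : Fin m) (hij : i ≠ j) (t : ℝ) (x : Vec m) :
    HasDerivAt (fun t => planeRotation i j hij t x)
      (planeRotation i j hij t x i • EuclideanSpace.single j 1
        - planeRotation i j hij t x j • EuclideanSpace.single i 1) t := by
  simp only [planeRotation_apply]
  have h1 : HasDerivAt (fun t => (Real.cos t - 1) * x i - Real.sin t * x j)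
      (-Real.sin t * x i - Real.cos t * x j) t :=
    (((Real.hasDerivAt_cos t).sub_const 1).mul_const _).sub
      ((Real.hasDerivAt_sin t).mul_const _)
  have h2 : HasDerivAt (fun t => Real.sin t * x i + (Real.cos t - 1) * x j)
      (Real.cos t * x i + -Real.sin t * x j) t :=
    ((Real.hasDerivAt_sin t).mul_const _).add
      (((Real.hasDerivAt_cos t).sub_const 1).mul_const _)
  have h := (((hasDerivAt_const t x).add (h1.smul_const (EuclideanSpace.single i (1 : ℝ)))).add
    (h2.smul_const (EuclideanSpace.single j (1 : ℝ))))
  refine h.congr_deriv ?_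
  simp [hij, hij.symm]
  module

theorem hasDerivAt_comp_planeRotation (i j : Fin m) (hij : i ≠ j) {f : Vec m → F} {t : ℝ}
    {x : Vec m} (hf : DifferentiableAt ℝ f (planeRotation i j hij t x)) :
    HasDerivAt (fun t => f (planeRotation i j hij t x))
      (angularDeriv i j f (planeRotation i j hij t x)) t :=
  hf.hasFDerivAt.comp_hasDerivAt t (hasDerivAt_planeRotation i j hij t x)

/-- The operators `x_i ∂_{x_j} - x_j ∂_{x_i}` are tangential to the spheres. -/
theorem angularDeriv_congr (i j : Fin m) {f g : Vec m → F} {r : ℝ}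
    (h : ∀ x ∈ Metric.sphere (0 : Vec m) r, f x = g x) {x : Vec m}
    (hx : x ∈ Metric.sphere (0 : Vec m) r)
    (hf : DifferentiableAt ℝ f x) (hg : DifferentiableAt ℝ g x) :
    angularDeriv i j f x = angularDeriv i j g x := by
  rcases eq_or_ne i j with rfl | hij
  · simp [angularDeriv_self]
  have h0 := planeRotation_zero i j hij x
  have hf' := hasDerivAt_comp_planeRotation i j hij (f := f) (t := 0) (x := x) (by rwa [h0])
  have hg' := hasDerivAt_comp_planeRotation i j hij (f := g) (t := 0) (x := x) (by rwa [h0])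
  have : (fun t => f (planeRotation i j hij t x)) = fun t => g (planeRotation i j hij t x) := by
    funext t
    exact h _ (by simpa using hx)
  rw [this, h0] at hf'
  rw [h0] at hg'
  exact hf'.unique hg'

/-- The integral of `f` composed with the rotation by angle $t$ does not depend on $t$. Its
$t$-derivative is the integral of the rotated angular derivative, which by the same invariance is
also constant in $t$. The fundamental theorem on $[0,1]$ then makes that constant zero. -/
theorem sphereIntegral_angularDeriv [CompleteSpace F] (i j : Fin m) {r : ℝ} (hr : 0 ≤ r)
    {f : Vec m → F} (hf : ∀ x ∈ Metric.sphere (0 : Vec m) r, DifferentiableAt ℝ f x)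
    (hc : ContinuousOn (angularDeriv i j f) (Metric.sphere 0 r)) :
    sphereIntegral r (angularDeriv i j f) = 0 := by
  rcases eq_or_ne i j with rfl | hij
  · simp [sphereIntegral, angularDeriv_self]
  have hmem : ∀ t (ξ : Metric.sphere (0 : Vec m) 1),
      planeRotation i j hij t (r • (ξ : Vec m)) ∈ Metric.sphere (0 : Vec m) r := fun t ξ => by
    have := smul_mem_sphere hr ξ
    rw [mem_sphere_zero_iff_norm] at this ⊢
    rw [LinearIsometryEquiv.norm_map, this]
  have hfc : ContinuousOn f (Metric.sphere 0 r) := fun x hx => (hf x hx).continuousAt.continuousWithinAt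
  have key := integral_sub_integral_eq_intervalIntegral_deriv (m := m) (a := 0) (b := 1)
    (Φ := fun t ξ => f (planeRotation i j hij t (r • (ξ : Vec m))))
    (Φ' := fun t ξ => angularDeriv i j f (planeRotation i j hij t (r • (ξ : Vec m))))
    (fun t _ ξ => hasDerivAt_comp_planeRotation i j hij (hf _ (hmem t ξ)))
    (fun t _ => hfc.comp_continuous
      ((planeRotation i j hij t).continuous.comp (by fun_prop)) (hmem t))
    (Continuous.continuousOn (hc.comp_continuous
      ((continuous_planeRotation i j hij).comp (f := fun p : ℝ × Metric.sphere (0 : Vec m) 1 =>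
        (p.1, r • (p.2 : Vec m))) (by fun_prop)) fun p => hmem p.1 p.2))
  have e1 : ∀ t, (∫ ξ : Metric.sphere (0 : Vec m) 1, f (planeRotation i j hij t (r • (ξ : Vec m)))
      ∂(volume : Measure (Vec m)).toSphere) = sphereIntegral r f := fun t =>
    sphereIntegral_comp (planeRotation i j hij t) hr hfc
  have e2 : ∀ t, (∫ ξ : Metric.sphere (0 : Vec m) 1,
      angularDeriv i j f (planeRotation i j hij t (r • (ξ : Vec m)))
      ∂(volume : Measure (Vec m)).toSphere) = sphereIntegral r (angularDeriv i j f) := fun t =>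
    sphereIntegral_comp (planeRotation i j hij t) hr hc
  simp only [e1, e2, sub_self] at key
  simpa using key.symm

theorem analyticAt_angularDeriv [CompleteSpace F] (i j : Fin m) {f : Vec m → F} {x : Vec m}
    (hf : AnalyticAt ℝ f x) : AnalyticAt ℝ (angularDeriv i j f) x := by
  unfold angularDeriv
  have h1 : AnalyticAt ℝ (fun y : Vec m =>
      y i • (EuclideanSpace.single j 1 : Vec m) - y j • EuclideanSpace.single i 1) x := by
    refine .sub (.fun_smul ?_ analyticAt_const) (.fun_smul ?_ analyticAt_const)
    · exact (EuclideanSpace.proj i : Vec m →L[ℝ] ℝ).analyticAt x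
    · exact (EuclideanSpace.proj j : Vec m →L[ℝ] ℝ).analyticAt x
  exact ((ContinuousLinearMap.id ℝ (Vec m →L[ℝ] F)).analyticAt_bilinear (_, _)).comp₂ hf.fderiv h1

/-- Integration by parts for the operators `x_i ∂_{x_j} - x_j ∂_{x_i}` on a sphere. -/
theorem sphereIntegral_angularDeriv_bilinear [CompleteSpace F] {E₁ E₂ : Type*}
    [NormedAddCommGroup E₁] [NormedSpace ℝ E₁] [CompleteSpace E₁]
    [NormedAddCommGroup E₂] [NormedSpace ℝ E₂] [CompleteSpace E₂] (B : E₁ →L[ℝ] E₂ →L[ℝ] F)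
    (i j : Fin m) {r : ℝ} (hr : 0 ≤ r) {f : Vec m → E₁} {g : Vec m → E₂}
    (hf : AnalyticOnNhd ℝ f (Metric.sphere 0 r)) (hg : AnalyticOnNhd ℝ g (Metric.sphere 0 r)) :
    sphereIntegral r (fun x => B (f x) (angularDeriv i j g x)) =
      -sphereIntegral r (fun x => B (angularDeriv i j f x) (g x)) := by
  have hBan : AnalyticOnNhd ℝ (fun x => B (f x) (g x)) (Metric.sphere 0 r) := fun x hx =>
    (B.analyticAt_bilinear (f x, g x)).comp₂ (hf x hx) (hg x hx)
  have h1 : AnalyticOnNhd ℝ (fun x => B (f x) (angularDeriv i j g x)) (Metric.sphere 0 r) :=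
    fun x hx => (B.analyticAt_bilinear (f x, _)).comp₂ (hf x hx)
      (analyticAt_angularDeriv i j (hg x hx))
  have h2 : AnalyticOnNhd ℝ (fun x => B (angularDeriv i j f x) (g x)) (Metric.sphere 0 r) :=
    fun x hx => (B.analyticAt_bilinear (_, g x)).comp₂
      (analyticAt_angularDeriv i j (hf x hx)) (hg x hx)
  have key := sphereIntegral_angularDeriv i j hr (fun x hx => (hBan x hx).differentiableAt)
    (fun x hx => (analyticAt_angularDeriv i j (hBan x hx)).continuousAt.continuousWithinAt)
  rw [sphereIntegral_congr hr (ψ := fun x => B (f x) (angularDeriv i j g x)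
    + B (angularDeriv i j f x) (g x)), sphereIntegral_add hr h1.continuousOn h2.continuousOn] at key
  · exact eq_neg_of_add_eq_zero_left key
  · intro x hx
    have := B.hasFDerivAt_of_bilinear (hf x hx).differentiableAt.hasFDerivAt
      (hg x hx).differentiableAt.hasFDerivAt
    rw [angularDeriv, this.fderiv]
    simp [angularDeriv]

end Rotation

/-! ### Clifford algebra and the Gamma operator -/

section Algebra

variable {m : ℕ}

instance instFiniteDimensionalCl (m : ℕ) : FiniteDimensional ℝ (Cl m) :=
  Module.Basis.finiteDimensional_of_finite (clBasis m)

instance instCompleteSpaceCl (m : ℕ) : CompleteSpace (Cl m) :=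
  FiniteDimensional.complete ℝ (Cl m)

/-- The Clifford product as a continuous bilinear map. -/
noncomputable def clMul (m : ℕ) : Cl m →L[ℝ] Cl m →L[ℝ] Cl m :=
  (LinearMap.mul ℝ (Cl m)).toContinuousBilinearMap

@[simp]
theorem clMul_apply (a b : Cl m) : clMul m a b = a * b := rfl

theorem continuous_clMul : Continuous fun p : Cl m × Cl m => p.1 * p.2 :=
  (clMul m).continuous₂

/-- Reversion as a continuous linear map. -/
noncomputable def clReverse (m : ℕ) : Cl m →L[ℝ] Cl m :=
  LinearMap.toContinuousLinearMap (CliffordAlgebra.reverse (Q := negForm m))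

theorem clReverse_mul (a b : Cl m) : clReverse m (a * b) = clReverse m b * clReverse m a :=
  CliffordAlgebra.reverse.map_mul a b

theorem clReverse_e (j : Fin m) : clReverse m (e j) = e j :=
  CliffordAlgebra.reverse_ι _

theorem clReverse_clReverse (a : Cl m) : clReverse m (clReverse m a) = a :=
  CliffordAlgebra.reverse_reverse a

theorem e_mul_e_self (i : Fin m) : (e i * e i : Cl m) = -1 := by
  have h := e_mul_e_add i i
  rw [if_pos rfl, ← two_smul ℝ, show (-2 : ℝ) = 2 * (-1) by norm_num, ← smul_eq_mul,
    Algebra.algebraMap_eq_smul_one, smul_eq_mul, mul_smul] at h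
  have := smul_right_injective _ (two_ne_zero (α := ℝ)) h
  simpa using this

theorem e_mul_e_comm {i j : Fin m} (hij : i ≠ j) : (e i * e j : Cl m) = -(e j * e i) := by
  have h := e_mul_e_add i j
  rw [if_neg hij, map_zero] at h
  exact eq_neg_of_add_eq_zero_left h

/-- The vector variable as a continuous linear map. -/
noncomputable def vecL (m : ℕ) : Vec m →L[ℝ] Cl m :=
  ∑ j : Fin m, (EuclideanSpace.proj j : Vec m →L[ℝ] ℝ).smulRight (e j)

theorem vecL_apply (x : Vec m) : vecL m x = vec x := by
  simp [vecL, vec]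

theorem vec_smul (c : ℝ) (x : Vec m) : vec (c • x) = c • vec x := by
  simp only [← vecL_apply, map_smul]

theorem vec_single (j : Fin m) : vec (EuclideanSpace.single j (1 : ℝ) : Vec m) = e j := by
  rw [vec, Finset.sum_eq_single j]
  · simp
  · intro b _ hb
    simp [hb]
  · simp

theorem e_mul_vec (k : Fin m) (x : Vec m) : e k * vec x = -(vec x * e k) - (2 * x k) • 1 := by
  have h : e k * vec x + vec x * e k = -((2 * x k) • 1) := by
    simp only [vec, Finset.mul_sum, Finset.sum_mul, ← Finset.sum_add_distrib,
      mul_smul_comm, smul_mul_assoc, ← smul_add, e_mul_e_add]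
    rw [Finset.sum_eq_single k]
    · rw [if_pos rfl, Algebra.algebraMap_eq_smul_one, smul_smul, ← neg_smul]
      congr 1
      ring
    · intro b _ hb
      simp [hb.symm]
    · simp
  rw [eq_sub_of_add_eq h]
  abel

theorem vec_mul_vec (x : Vec m) : vec x * vec x = -(‖x‖ ^ 2 • (1 : Cl m)) := by
  -- Weighting the relation `e_mul_vec` by $x_k$ and summing over $k$ expresses $x^2$ through
  -- $-x^2$; the value follows on dividing by 2.
  have h : vec x * vec x = -(vec x * vec x) - (2 * ‖x‖ ^ 2) • (1 : Cl m) := by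
    have h0 : vec x * vec x = ∑ k, (x k • e k : Cl m) * vec x := by
      rw [← Finset.sum_mul, ← vec]
    have : ∀ k, (x k • e k : Cl m) * vec x = -(vec x * (x k • e k)) - (2 * x k ^ 2) • 1 := by
      intro k
      rw [smul_mul_assoc, e_mul_vec, mul_smul_comm, smul_sub, smul_neg, smul_smul]
      congr 2
      ring
    have hv : ∑ k, vec x * (x k • e k) = vec x * vec x := by
      rw [← Finset.mul_sum, vec]
    refine h0.trans ?_
    simp only [this, Finset.sum_sub_distrib, Finset.sum_neg_distrib, hv,
      ← Finset.sum_smul, ← Finset.mul_sum, EuclideanSpace.norm_sq_eq, Real.norm_eq_abs, sq_abs]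
  have h2 : (2 : ℝ) • (vec x * vec x) = (2 : ℝ) • (-(‖x‖ ^ 2 • (1 : Cl m))) := by
    rw [two_smul]
    nth_rewrite 1 [h]
    module
  exact smul_right_injective _ (two_ne_zero (α := ℝ)) h2

theorem vec_mul_vecInv {x : Vec m} (hx : x ≠ 0) : vec x * vecInv x = 1 := by
  rw [vecInv, mul_neg, mul_smul_comm, vec_mul_vec, smul_neg, neg_neg, smul_smul,
    inv_mul_cancel₀ (by simpa using hx), one_smul]

theorem vecInv_mul_vec {x : Vec m} (hx : x ≠ 0) : vecInv x * vec x = 1 := by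
  rw [vecInv, neg_mul, smul_mul_assoc, vec_mul_vec, smul_neg, neg_neg, smul_smul,
    inv_mul_cancel₀ (by simpa using hx), one_smul]

theorem vecInv_mul_vecInv (x : Vec m) : vecInv x * vecInv x = -((‖x‖ ^ 2)⁻¹ • (1 : Cl m)) := by
  rcases eq_or_ne x 0 with rfl | hx
  · simp [vecInv]
  · rw [vecInv, neg_mul_neg, smul_mul_smul_comm, vec_mul_vec, smul_neg, smul_smul, mul_assoc,
      inv_mul_cancel₀ (by simpa using hx), mul_one]

theorem vecInv_smul (c : ℝ) (x : Vec m) : vecInv (c • x) = c⁻¹ • vecInv x := by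
  rcases eq_or_ne c 0 with rfl | hc
  · simp [vecInv]
  · rw [vecInv, vecInv, vec_smul, norm_smul, smul_neg, smul_smul, smul_smul, mul_pow,
      Real.norm_eq_abs, sq_abs]
    congr 2
    field_simp

theorem partialDeriv_comp_clm (L : Cl m →L[ℝ] Cl m) (j : Fin m) {f : Vec m → Cl m} {x : Vec m}
    (hf : DifferentiableAt ℝ f x) :
    partialDeriv j (fun y => L (f y)) x = L (partialDeriv j f x) := by
  unfold partialDeriv
  have h : HasFDerivAt (fun y => L (f y)) (L.comp (fderiv ℝ f x)) x :=
    L.hasFDerivAt.comp x hf.hasFDerivAt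
  rw [h.fderiv]
  rfl

theorem Gamma_eq_angularDeriv (f : Vec m → Cl m) (x : Vec m) :
    Gamma f x = -∑ i : Fin m, ∑ j : Fin m,
      if i < j then e i * e j * angularDeriv i j f x else 0 := by
  simp [Gamma, angularDeriv, partialDeriv]

/-- `Γ = -x ∂ - E` in terms of the Dirac operator and the Euler operator. -/
theorem Gamma_eq (f : Vec m → Cl m) (x : Vec m) :
    Gamma f x = -(vec x * ∑ j, e j * partialDeriv j f x) - ∑ j, x j • partialDeriv j f x := by
  set d : Fin m → Cl m := fun j => partialDeriv j f x
  set S : Fin m → Fin m → Cl m := fun i j => x i • (e i * e j * d j)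
  have h1 : ∀ i j : Fin m, (if i < j then e i * e j * (x i • d j - x j • d i) else 0) =
      (if i < j then S i j else 0) + (if i < j then S j i else 0) := by
    intro i j
    split_ifs with h
    · simp only [S, mul_sub, mul_smul_comm, e_mul_e_comm h.ne', neg_mul, smul_neg]
      abel
    · simp
  have h2 : vec x * ∑ j, e j * d j = ∑ i, ∑ j, S i j := by
    simp only [vec, Finset.sum_mul, Finset.mul_sum, S, smul_mul_assoc, mul_assoc]
    exact Finset.sum_comm
  -- The off-diagonal part of $\underline{x}\,\partial$ is $-\Gamma$; the diagonal part is minus the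
  -- Euler operator because $e_i^2=-1$.
  have h3 : ∀ i j : Fin m, S i j = ((if i < j then S i j else 0) + (if j < i then S i j else 0)) +
      (if i = j then S i j else 0) := by
    intro i j
    rcases lt_trichotomy i j with h | h | h
    · simp [h, h.not_gt, h.ne]
    · simp [h]
    · simp [h, h.not_gt, h.ne']
  have h4 : ∑ i, ∑ j, (if i = j then S i j else 0) = -∑ j, x j • d j := by
    simp [S, e_mul_e_self, ← Finset.sum_neg_distrib]
  have h5 : ∑ i, ∑ j, (if i < j then S j i else 0) = ∑ i, ∑ j, (if j < i then S i j else 0) :=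
    Finset.sum_comm
  have h6 : Gamma f x = -∑ i, ∑ j, ((if i < j then S i j else 0) + (if i < j then S j i else 0)) := by
    simp only [← h1]
    rfl
  have h7 : ∑ i, ∑ j, S i j = ∑ i, ∑ j, ((if i < j then S i j else 0) + (if i < j then S j i else 0))
      - ∑ j, x j • d j := by
    rw [sub_eq_add_neg, ← h4]
    simp only [Finset.sum_add_distrib, h5]
    simp only [← Finset.sum_add_distrib]
    exact Finset.sum_congr rfl fun i _ => Finset.sum_congr rfl fun j _ => h3 i j
  rw [h6, h2, h7]
  abel

theorem Gamma_add {f g : Vec m → Cl m} {x : Vec m} (hf : DifferentiableAt ℝ f x)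
    (hg : DifferentiableAt ℝ g x) : Gamma (fun y => f y + g y) x = Gamma f x + Gamma g x := by
  simp only [Gamma_eq, partialDeriv, fderiv_fun_add hf hg, add_apply, mul_add,
    smul_add, Finset.sum_add_distrib]
  abel

theorem Gamma_const_smul (c : ℝ) {f : Vec m → Cl m} {x : Vec m} (hf : DifferentiableAt ℝ f x) :
    Gamma (fun y => c • f y) x = c • Gamma f x := by
  simp only [Gamma_eq, partialDeriv, fderiv_fun_const_smul hf, smul_apply,
    mul_smul_comm, smul_comm _ c, ← Finset.smul_sum, smul_sub, smul_neg]

theorem Gamma_comp_smul (c : ℝ) (f : Vec m → Cl m) (x : Vec m) :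
    Gamma (fun y => f (c • y)) x = Gamma f (c • x) := by
  have h : ∀ j, partialDeriv j (fun y => f (c • y)) x = c • partialDeriv j f (c • x) := by
    intro j
    simp [partialDeriv, fderiv_comp_smul]
  simp only [Gamma_eq, h, vec_smul, PiLp.smul_apply, smul_eq_mul, mul_smul_comm, smul_mul_assoc,
    ← Finset.smul_sum, smul_smul]
  simp only [mul_comm _ c]

/-- $\Gamma$ differentiates only along spheres. This allows identities known on a single sphere to
be differentiated by $\Gamma$. -/
theorem Gamma_congr {f g : Vec m → Cl m} {r : ℝ}
    (h : ∀ x ∈ Metric.sphere (0 : Vec m) r, f x = g x) {x : Vec m}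
    (hx : x ∈ Metric.sphere (0 : Vec m) r)
    (hf : DifferentiableAt ℝ f x) (hg : DifferentiableAt ℝ g x) :
    Gamma f x = Gamma g x := by
  simp only [Gamma_eq_angularDeriv]
  congr 1
  refine Finset.sum_congr rfl fun i _ => Finset.sum_congr rfl fun j _ => ?_
  rw [angularDeriv_congr i j h hx hf hg]

theorem analyticAt_Gamma {f : Vec m → Cl m} {x : Vec m} (hf : AnalyticAt ℝ f x) :
    AnalyticAt ℝ (Gamma f) x := by
  have : Gamma f = fun x => -∑ i : Fin m, ∑ j : Fin m,
      if i < j then e i * e j * angularDeriv i j f x else 0 :=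
    funext fun x => Gamma_eq_angularDeriv f x
  rw [this]
  refine AnalyticAt.fun_neg (Finset.analyticAt_fun_sum _ fun i _ =>
    Finset.analyticAt_fun_sum _ fun j _ => ?_)
  split_ifs
  · exact ((clMul m (e i * e j)).analyticAt _).comp (analyticAt_angularDeriv i j hf)
  · exact analyticAt_const

/-- `Γ x = x (m - 1 - Γ)`. -/
theorem Gamma_vec_mul {f : Vec m → Cl m} {x : Vec m} (hf : DifferentiableAt ℝ f x) :
    Gamma (fun y => vec y * f y) x = ((m : ℝ) - 1) • (vec x * f x) - vec x * Gamma f x := by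
  have hp : ∀ j, partialDeriv j (fun y => vec y * f y) x =
      e j * f x + vec x * partialDeriv j f x := by
    intro j
    have h := (clMul m).hasFDerivAt_of_bilinear ((vecL m).hasFDerivAt (x := x)) hf.hasFDerivAt
    simp only [clMul_apply, vecL_apply] at h
    rw [partialDeriv, h.fderiv]
    simp only [add_apply, ContinuousLinearMap.precompR_apply,
      ContinuousLinearMap.precompL_apply, clMul_apply, vecL_apply, vec_single]
    rw [add_comm]
    rfl
  set d : Fin m → Cl m := fun j => partialDeriv j f x
  have h1 : ∑ j, e j * (e j * f x + vec x * d j) =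
      -((m : ℝ) • f x) - vec x * ∑ j, e j * d j - (2 : ℝ) • ∑ j, x j • d j := by
    have : ∀ j, e j * (e j * f x + vec x * d j) =
        -f x - vec x * (e j * d j) - (2 : ℝ) • (x j • d j) := by
      intro j
      rw [mul_add, ← mul_assoc, e_mul_e_self, ← mul_assoc, e_mul_vec, sub_mul, smul_mul_assoc,
        one_mul, smul_smul, neg_mul, neg_mul, mul_assoc, one_mul]
      abel
    simp only [this, Finset.sum_sub_distrib, ← Finset.mul_sum, ← Finset.smul_sum]
    simp [Nat.cast_smul_eq_nsmul]
  have h2 : ∑ j, x j • (e j * f x + vec x * d j) = vec x * f x + vec x * ∑ j, x j • d j := by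
    simp only [smul_add, Finset.sum_add_distrib, Finset.mul_sum, mul_smul_comm]
    congr 1
    simp only [vec, Finset.sum_mul, smul_mul_assoc]
  rw [Gamma_eq, Gamma_eq]
  simp only [hp]
  rw [h1, h2]
  simp only [mul_sub, mul_neg, mul_smul_comm]
  module

end Algebra

/-! ### The spherical Laplacian $-(\Gamma^2-(m-2)\Gamma)$ and its symmetry -/

section Casimir

variable {m : ℕ}

/-- Symmetrizing $e_ke_j$ against a symmetric array leaves only
$\tfrac12(e_ke_j+e_je_k)=-\delta_{kj}$. For a Hessian this says that the Dirac operator squares to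
minus the Laplacian. -/
theorem sum_e_mul_sum_symm {h : Fin m → Fin m → Cl m} (hs : ∀ k j, h k j = h j k) :
    ∑ k, e k * ∑ j, e j * h k j = -∑ k, h k k := by
  have h0 : ∑ k, e k * ∑ j, e j * h k j = ∑ k, ∑ j, e k * e j * h k j := by
    simp only [Finset.mul_sum, mul_assoc]
  have h1 : ∑ k, ∑ j, e k * e j * h k j = ∑ k, ∑ j, e j * e k * h k j := by
    rw [Finset.sum_comm]
    exact Finset.sum_congr rfl fun k _ => Finset.sum_congr rfl fun j _ => by rw [hs j k]
  have h2 : (2 : ℝ) • ∑ k, e k * ∑ j, e j * h k j = (2 : ℝ) • -∑ k, h k k := by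
    rw [h0, two_smul]
    nth_rewrite 2 [h1]
    simp only [← Finset.sum_add_distrib, ← add_mul, e_mul_e_add]
    simp [Finset.smul_sum, Algebra.algebraMap_eq_smul_one]
  exact smul_right_injective _ (two_ne_zero (α := ℝ)) h2

/-- The pointwise algebra behind `casimir_eq`: `d` stands for the gradient of $f$ and `h` for its
Hessian. The repeated bracket is $\partial_k\Gamma f$ as computed in `partialDeriv_Gamma`, so the
left side is $\Gamma\Gamma f$. The terms in $\Gamma f$ gather into $(m-2)\Gamma f$ and no Clifford
generator survives in the rest. -/
theorem casimir_algebra (x : Vec m) (d : Fin m → Cl m) {h : Fin m → Fin m → Cl m}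
    (hs : ∀ k j, h k j = h j k) :
    -(vec x * ∑ k, e k * (-(e k * ∑ j, e j * d j) - vec x * ∑ j, e j * h k j - d k
        - ∑ i, x i • h k i))
      - ∑ k, x k • (-(e k * ∑ j, e j * d j) - vec x * ∑ j, e j * h k j - d k - ∑ i, x i • h k i) =
    ((m : ℝ) - 2) • (-(vec x * ∑ j, e j * d j) - ∑ i, x i • d i)
      + (-(‖x‖ ^ 2 • ∑ k, h k k) + ((m : ℝ) - 1) • ∑ i, x i • d i + ∑ k, x k • ∑ i, x i • h k i) := by
  set D : Cl m := ∑ j, e j * d j with hD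
  set N : Cl m := ∑ k, e k * ∑ i, x i • h k i with hN
  set M : Fin m → Cl m := fun k => ∑ j, e j * h k j with hM
  have h1 : ∑ k : Fin m, e k * (e k * D) = -((m : ℝ) • D) := by
    simp [← mul_assoc, e_mul_e_self, Nat.cast_smul_eq_nsmul]
  have h3 : ∑ k, x k • M k = N := by
    simp only [hM, hN, Finset.smul_sum, Finset.mul_sum, mul_smul_comm]
    rw [Finset.sum_comm]
    exact Finset.sum_congr rfl fun k _ => Finset.sum_congr rfl fun j _ => by rw [hs j k]
  have h2 : ∑ k, e k * (vec x * M k) = vec x * ∑ k, h k k - (2 : ℝ) • N := by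
    have : ∀ k, e k * (vec x * M k) = -(vec x * (e k * M k)) - (2 : ℝ) • (x k • M k) := by
      intro k
      rw [← mul_assoc, e_mul_vec, sub_mul, smul_mul_assoc, one_mul, neg_mul, mul_assoc, smul_smul]
    simp only [this, Finset.sum_sub_distrib, Finset.sum_neg_distrib, ← Finset.mul_sum,
      ← Finset.smul_sum, h3]
    rw [sum_e_mul_sum_symm hs, mul_neg, neg_neg]
  have h4 : ∑ k, e k * (-(e k * D) - vec x * M k - d k - ∑ i, x i • h k i) =
      ((m : ℝ) - 1) • D - vec x * ∑ k, h k k + N := by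
    simp only [mul_sub, mul_neg, Finset.sum_sub_distrib, Finset.sum_neg_distrib, h1, h2, ← hD, ← hN]
    module
  have h5 : ∑ k, x k • (-(e k * D) - vec x * M k - d k - ∑ i, x i • h k i) =
      -(vec x * D) - vec x * N - ∑ i, x i • d i - ∑ k, x k • ∑ i, x i • h k i := by
    simp only [smul_sub, smul_neg, Finset.sum_sub_distrib, Finset.sum_neg_distrib,
      ← mul_smul_comm, ← Finset.mul_sum, h3]
    simp only [mul_smul_comm, ← smul_mul_assoc, ← Finset.sum_mul, ← vec.eq_1]
  change -(vec x * ∑ k, e k * (-(e k * D) - vec x * M k - d k - ∑ i, x i • h k i))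
      - ∑ k, x k • (-(e k * D) - vec x * M k - d k - ∑ i, x i • h k i) = _
  rw [h4, h5, mul_add, mul_sub, ← mul_assoc, vec_mul_vec]
  simp only [mul_smul_comm, neg_mul, smul_mul_assoc, one_mul]
  module

/-- The operator `Γ² - (m - 2) Γ`, which is the negative of the spherical Laplacian. -/
noncomputable def casimir (f : Vec m → Cl m) (x : Vec m) : Cl m :=
  Gamma (Gamma f) x - ((m : ℝ) - 2) • Gamma f x

theorem partialDeriv_partialDeriv_comm (i j : Fin m) {f : Vec m → Cl m} {x : Vec m}
    (hf : AnalyticAt ℝ f x) :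
    partialDeriv i (partialDeriv j f) x = partialDeriv j (partialDeriv i f) x := by
  have hsymm : IsSymmSndFDerivAt ℝ f x :=
    hf.contDiffAt (n := 2) |>.isSymmSndFDerivAt (by simp)
  have h : ∀ i j : Fin m, partialDeriv i (partialDeriv j f) x =
      fderiv ℝ (fderiv ℝ f) x (EuclideanSpace.single i 1) (EuclideanSpace.single j 1) := by
    intro i j
    have h1 : HasFDerivAt (partialDeriv j f) _ x :=
      hf.fderiv.differentiableAt.hasFDerivAt.clm_apply
        (hasFDerivAt_const (EuclideanSpace.single j (1 : ℝ) : Vec m) x)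
    rw [partialDeriv, h1.fderiv]
    simp
  rw [h, h]
  exact hsymm _ _

theorem analyticAt_partialDeriv (j : Fin m) {f : Vec m → Cl m} {x : Vec m}
    (hf : AnalyticAt ℝ f x) : AnalyticAt ℝ (partialDeriv j f) x :=
  ((ContinuousLinearMap.apply ℝ (Cl m) (EuclideanSpace.single j (1 : ℝ) : Vec m)).analyticAt
    _).comp hf.fderiv

theorem partialDeriv_Gamma (k : Fin m) {f : Vec m → Cl m} {x : Vec m} (hf : AnalyticAt ℝ f x) :
    partialDeriv k (Gamma f) x = -(e k * ∑ j, e j * partialDeriv j f x)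
      - vec x * ∑ j, e j * partialDeriv k (partialDeriv j f) x - partialDeriv k f x
      - ∑ i, x i • partialDeriv k (partialDeriv i f) x := by
  have hd : ∀ j, HasFDerivAt (partialDeriv j f) (fderiv ℝ (partialDeriv j f) x) x := fun j =>
    (analyticAt_partialDeriv j hf).differentiableAt.hasFDerivAt
  have h1 : HasFDerivAt (fun y => ∑ j, e j * partialDeriv j f y)
      (∑ j, (clMul m (e j)).comp (fderiv ℝ (partialDeriv j f) x)) x :=
    HasFDerivAt.fun_sum fun j _ => (clMul m (e j)).hasFDerivAt.comp x (hd j)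
  have h2 := (clMul m).hasFDerivAt_of_bilinear ((vecL m).hasFDerivAt (x := x)) h1
  have h3 : HasFDerivAt (fun y : Vec m => ∑ j, y j • partialDeriv j f y) _ x :=
    HasFDerivAt.fun_sum fun j _ =>
      ((EuclideanSpace.proj j : Vec m →L[ℝ] ℝ).hasFDerivAt (x := x)).smul (hd j)
  have h4 := h2.fun_neg.fun_sub h3
  simp only [clMul_apply, vecL_apply] at h4
  have h5 : Gamma f = fun y => -(vec y * ∑ j, e j * partialDeriv j f y)
      - ∑ j, y j • partialDeriv j f y := funext fun y => Gamma_eq f y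
  rw [partialDeriv, h5, h4.fderiv]
  simp [vecL_apply, vec_single, Finset.sum_add_distrib, partialDeriv]
  simp only [Finset.mul_sum]
  abel

/-- The operator `casimir` is scalar: it acts on each coordinate of the Clifford algebra. -/
theorem casimir_eq {f : Vec m → Cl m} {x : Vec m} (hf : AnalyticAt ℝ f x) :
    casimir f x = -(‖x‖ ^ 2 • ∑ k, partialDeriv k (partialDeriv k f) x)
      + ((m : ℝ) - 1) • ∑ i, x i • partialDeriv i f x
      + ∑ k, x k • ∑ i, x i • partialDeriv k (partialDeriv i f) x := by
  have h := casimir_algebra x (fun j => partialDeriv j f x)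
    (h := fun k j => partialDeriv k (partialDeriv j f) x)
    (fun k j => partialDeriv_partialDeriv_comm k j hf)
  simp only [← partialDeriv_Gamma _ hf, ← Gamma_eq] at h
  rw [casimir, h]
  abel

/-- By `casimir_eq` the operator has real coefficients, so it commutes with every linear map of the
values. It is applied to reversion, which does not commute with $\Gamma$ itself. -/
theorem casimir_comp_clm (L : Cl m →L[ℝ] Cl m) {f : Vec m → Cl m} {x : Vec m}
    (hf : AnalyticAt ℝ f x) : casimir (fun y => L (f y)) x = L (casimir f x) := by
  have hL : AnalyticAt ℝ (fun y => L (f y)) x := (L.analyticAt _).comp hf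
  have h2 : ∀ k i, partialDeriv k (partialDeriv i (fun y => L (f y))) x =
      L (partialDeriv k (partialDeriv i f) x) := by
    intro k i
    have : partialDeriv i (fun y => L (f y)) =ᶠ[𝓝 x] fun y => L (partialDeriv i f y) := by
      filter_upwards [hf.eventually_analyticAt] with y hy
      exact partialDeriv_comp_clm L i hy.differentiableAt
    rw [partialDeriv, this.fderiv_eq]
    exact partialDeriv_comp_clm L k (analyticAt_partialDeriv i hf).differentiableAt
  rw [casimir_eq hL, casimir_eq hf]
  simp only [h2, partialDeriv_comp_clm L _ hf.differentiableAt, map_add, map_neg, map_smul, map_sum]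

theorem analyticAt_mul {f g : Vec m → Cl m} {x : Vec m} (hf : AnalyticAt ℝ f x)
    (hg : AnalyticAt ℝ g x) : AnalyticAt ℝ (fun y => f y * g y) x :=
  ((clMul m).analyticAt_bilinear (f x, g x)).comp₂ hf hg

/-- Integration by parts for $\Gamma$ against an arbitrary bilinear pairing. The adjoint `S` is left
abstract because two cases are needed: the Clifford product, where `S` is $\Gamma$ conjugated by
reversion, and an inner product with skew bivectors, where `S` is $\Gamma$. -/
theorem sphereIntegral_bilinear_Gamma {F : Type*} [NormedAddCommGroup F] [NormedSpace ℝ F]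
    [CompleteSpace F] (B C : Cl m →L[ℝ] Cl m →L[ℝ] F)
    (S : (Vec m → Cl m) → Vec m → Cl m)
    {r : ℝ} (hr : 0 ≤ r) {f g : Vec m → Cl m}
    (hS : ∀ x ∈ Metric.sphere (0 : Vec m) r, ∀ b, C (S f x) b =
      ∑ i : Fin m, ∑ j : Fin m, if i < j then B (angularDeriv i j f x) (e i * e j * b) else 0)
    (hf : AnalyticOnNhd ℝ f (Metric.sphere 0 r)) (hg : AnalyticOnNhd ℝ g (Metric.sphere 0 r)) :
    sphereIntegral r (fun x => B (f x) (Gamma g x)) =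
      sphereIntegral r (fun x => C (S f x) (g x)) := by
  have hcont : ∀ (i j : Fin m), AnalyticOnNhd ℝ (fun x => if i < j then
      B (f x) (e i * e j * angularDeriv i j g x) else 0) (Metric.sphere 0 r) := by
    intro i j x hx
    split_ifs
    · exact (B.analyticAt_bilinear (_, _)).comp₂ (hf x hx)
        (((clMul m (e i * e j)).analyticAt _).comp (analyticAt_angularDeriv i j (hg x hx)))
    · exact analyticAt_const
  have hcont' : ∀ (i j : Fin m), AnalyticOnNhd ℝ (fun x => if i < j then
      B (angularDeriv i j f x) (e i * e j * g x) else 0) (Metric.sphere 0 r) := by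
    intro i j x hx
    split_ifs
    · exact (B.analyticAt_bilinear (_, _)).comp₂ (analyticAt_angularDeriv i j (hf x hx))
        (((clMul m (e i * e j)).analyticAt _).comp (hg x hx))
    · exact analyticAt_const
  have h1 : sphereIntegral r (fun x => B (f x) (Gamma g x)) =
      -∑ i : Fin m, ∑ j : Fin m, sphereIntegral r (fun x => if i < j then
        B (f x) (e i * e j * angularDeriv i j g x) else 0) := by
    have : ∀ x, B (f x) (Gamma g x) = (-1 : ℝ) • ∑ i : Fin m, ∑ j : Fin m, if i < j then
        B (f x) (e i * e j * angularDeriv i j g x) else 0 := by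
      intro x
      rw [Gamma_eq_angularDeriv, map_neg, neg_one_smul]
      simp only [map_sum, apply_ite (B (f x)), map_zero]
    simp only [this]
    rw [sphereIntegral_smul, neg_one_smul, sphereIntegral_finset_sum _ hr]
    · congr 1
      exact Finset.sum_congr rfl fun i _ => sphereIntegral_finset_sum _ hr
        fun j _ => (hcont i j).continuousOn
    · exact fun i _ => continuousOn_finsetSum _ fun j _ => (hcont i j).continuousOn
  have h2 : sphereIntegral r (fun x => C (S f x) (g x)) =
      ∑ i : Fin m, ∑ j : Fin m, sphereIntegral r (fun x => if i < j then
        B (angularDeriv i j f x) (e i * e j * g x) else 0) := by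
    rw [sphereIntegral_congr hr fun x hx => hS x hx (g x), sphereIntegral_finset_sum _ hr]
    · exact Finset.sum_congr rfl fun i _ => sphereIntegral_finset_sum _ hr
        fun j _ => (hcont' i j).continuousOn
    · exact fun i _ => continuousOn_finsetSum _ fun j _ => (hcont' i j).continuousOn
  rw [h1, h2, ← Finset.sum_neg_distrib]
  refine Finset.sum_congr rfl fun i _ => ?_
  rw [← Finset.sum_neg_distrib]
  refine Finset.sum_congr rfl fun j _ => ?_
  by_cases hij : i < j
  · simp only [if_pos hij]
    have := sphereIntegral_angularDeriv_bilinear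
      (((ContinuousLinearMap.compL ℝ (Cl m) (Cl m) F).flip (clMul m (e i * e j))).comp B)
      i j hr hf hg
    simp only [ContinuousLinearMap.comp_apply, ContinuousLinearMap.flip_apply,
      ContinuousLinearMap.compL_apply, clMul_apply] at this
    rw [this, neg_neg]
  · simp [hij, sphereIntegral]

/-- Moving $\Gamma$ to the left factor leaves the bivectors to the right of $f$; conjugation by
reversion expresses this through the usual $\Gamma$. The minus sign of the integration by parts is
absorbed by $e_je_i=-e_ie_j$. -/
theorem sphereIntegral_mul_Gamma {r : ℝ} (hr : 0 ≤ r) {f g : Vec m → Cl m}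
    (hf : AnalyticOnNhd ℝ f (Metric.sphere 0 r)) (hg : AnalyticOnNhd ℝ g (Metric.sphere 0 r)) :
    sphereIntegral r (fun x => f x * Gamma g x) =
      sphereIntegral r (fun x => clReverse m (Gamma (fun y => clReverse m (f y)) x) * g x) := by
  refine sphereIntegral_bilinear_Gamma (clMul m) (clMul m)
    (fun f x => clReverse m (Gamma (fun y => clReverse m (f y)) x)) hr ?_ hf hg
  intro x hx b
  have hang : ∀ i j, angularDeriv i j (fun y => clReverse m (f y)) x =
      clReverse m (angularDeriv i j f x) := by
    intro i j
    have h : HasFDerivAt (fun y => clReverse m (f y)) ((clReverse m).comp (fderiv ℝ f x)) x :=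
      (clReverse m).hasFDerivAt.comp x (hf x hx).differentiableAt.hasFDerivAt
    rw [angularDeriv, h.fderiv]
    rfl
  simp only [clMul_apply]
  rw [Gamma_eq_angularDeriv]
  simp only [hang, map_neg, map_sum, neg_mul, Finset.sum_mul]
  rw [← Finset.sum_neg_distrib]
  refine Finset.sum_congr rfl fun i _ => ?_
  rw [← Finset.sum_neg_distrib]
  refine Finset.sum_congr rfl fun j _ => ?_
  split_ifs with hij
  · rw [clReverse_mul, clReverse_mul, clReverse_e, clReverse_e, clReverse_clReverse,
      e_mul_e_comm hij.ne']
    simp [mul_assoc]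
  · simp

/-- The operator `casimir` is symmetric for the product of the Clifford algebra. -/
theorem sphereIntegral_mul_casimir {r : ℝ} (hr : 0 ≤ r) {f g : Vec m → Cl m}
    (hf : AnalyticOnNhd ℝ f (Metric.sphere 0 r)) (hg : AnalyticOnNhd ℝ g (Metric.sphere 0 r)) :
    sphereIntegral r (fun x => f x * casimir g x) =
      sphereIntegral r (fun x => casimir f x * g x) := by
  have hΓ : ∀ {f : Vec m → Cl m}, AnalyticOnNhd ℝ f (Metric.sphere 0 r) →
      AnalyticOnNhd ℝ (Gamma f) (Metric.sphere 0 r) := fun hf x hx => analyticAt_Gamma (hf x hx)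
  have hrev : ∀ {f : Vec m → Cl m}, AnalyticOnNhd ℝ f (Metric.sphere 0 r) →
      AnalyticOnNhd ℝ (fun y => clReverse m (f y)) (Metric.sphere 0 r) := fun hf x hx =>
    ((clReverse m).analyticAt _).comp (hf x hx)
  have hmul : ∀ {f g : Vec m → Cl m}, AnalyticOnNhd ℝ f (Metric.sphere 0 r) →
      AnalyticOnNhd ℝ g (Metric.sphere 0 r) →
      ContinuousOn (fun y => f y * g y) (Metric.sphere 0 r) := fun hf hg x hx =>
    (analyticAt_mul (hf x hx) (hg x hx)).continuousAt.continuousWithinAt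
  set f' : Vec m → Cl m := fun y => clReverse m (f y)
  have hcas : ∀ x ∈ Metric.sphere (0 : Vec m) r,
      -- Integration by parts turns each power of $\Gamma$ into its conjugate by reversion; the
      -- scalar combination `casimir` equals its own conjugate.
      casimir f x = clReverse m (casimir f' x) := by
    intro x hx
    rw [casimir_comp_clm _ (hf x hx), clReverse_clReverse]
  have hsm : ContinuousOn (fun x => ((m : ℝ) - 2) • (f x * Gamma g x)) (Metric.sphere 0 r) :=
    (hmul hf (hΓ hg)).fun_const_smul _
  have hsm' : ContinuousOn (fun x => ((m : ℝ) - 2) • (clReverse m (Gamma f' x) * g x))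
      (Metric.sphere 0 r) := (hmul (hrev (hΓ (hrev hf))) hg).fun_const_smul _
  have e1 : sphereIntegral r (fun x => f x * casimir g x) =
      sphereIntegral r (fun x => f x * Gamma (Gamma g) x)
        - ((m : ℝ) - 2) • sphereIntegral r (fun x => f x * Gamma g x) := by
    simp only [casimir, mul_sub, mul_smul_comm]
    rw [sphereIntegral_sub hr (hmul hf (hΓ (hΓ hg))) hsm, sphereIntegral_smul]
  have e2 : sphereIntegral r (fun x => casimir f x * g x) =
      sphereIntegral r (fun x => clReverse m (Gamma (Gamma f') x) * g x)
        - ((m : ℝ) - 2) • sphereIntegral r (fun x => clReverse m (Gamma f' x) * g x) := by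
    rw [sphereIntegral_congr hr (fun x hx => by rw [hcas x hx])]
    simp only [casimir, map_sub, map_smul, sub_mul, smul_mul_assoc]
    rw [sphereIntegral_sub hr (hmul (hrev (hΓ (hΓ (hrev hf)))) hg) hsm', sphereIntegral_smul]
  rw [e1, e2, sphereIntegral_mul_Gamma hr hf (hΓ hg), sphereIntegral_mul_Gamma hr hf hg,
    sphereIntegral_mul_Gamma hr (hrev (hΓ (hrev hf))) hg]
  simp only [clReverse_clReverse]
  rfl

end Casimir

/-! ### Calculus of time-dependent functions -/

section TimeDependent

variable {m : ℕ}

theorem analyticAt_slice {G : ℝ → Vec m → Cl m} {u : ℝ} {x : Vec m}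
    (hG : AnalyticAt ℝ (fun p : ℝ × Vec m => G p.1 p.2) (u, x)) : AnalyticAt ℝ (G u) x :=
  hG.comp₂ analyticAt_const analyticAt_id

theorem analyticAt_time_slice {G : ℝ → Vec m → Cl m} {u : ℝ} {x : Vec m}
    (hG : AnalyticAt ℝ (fun p : ℝ × Vec m => G p.1 p.2) (u, x)) :
    AnalyticAt ℝ (fun v => G v x) u :=
  hG.comp₂ analyticAt_id analyticAt_const

theorem partialDeriv_slice (j : Fin m) {G : ℝ → Vec m → Cl m} {p : ℝ × Vec m}
    (hG : AnalyticAt ℝ (fun p : ℝ × Vec m => G p.1 p.2) p) :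
    partialDeriv j (G p.1) p.2 =
      fderiv ℝ (fun p : ℝ × Vec m => G p.1 p.2) p (0, EuclideanSpace.single j 1) := by
  have h : HasFDerivAt (G p.1) _ p.2 := HasFDerivAt.comp (f := fun y => (p.1, y)) p.2
    hG.differentiableAt.hasFDerivAt (hasFDerivAt_prodMk_right p.1 p.2)
  rw [partialDeriv, h.fderiv]
  simp

theorem deriv_time_slice {G : ℝ → Vec m → Cl m} {p : ℝ × Vec m}
    (hG : AnalyticAt ℝ (fun p : ℝ × Vec m => G p.1 p.2) p) :
    deriv (fun v => G v p.2) p.1 = fderiv ℝ (fun p : ℝ × Vec m => G p.1 p.2) p (1, 0) := by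
  have h : HasFDerivAt (fun v => G v p.2) _ p.1 := HasFDerivAt.comp (f := fun v => (v, p.2)) p.1
    hG.differentiableAt.hasFDerivAt (hasFDerivAt_prodMk_left p.1 p.2)
  rw [← fderiv_apply_one_eq_deriv, h.fderiv]
  simp

theorem analyticAt_fderiv_apply {E F : Type*} [NormedAddCommGroup E] [NormedSpace ℝ E]
    [NormedAddCommGroup F] [NormedSpace ℝ F] [CompleteSpace F] {f : E → F} {x : E}
    (hf : AnalyticAt ℝ f x) (v : E) : AnalyticAt ℝ (fun y => fderiv ℝ f y v) x :=
  ((ContinuousLinearMap.apply ℝ F v).analyticAt _).comp hf.fderiv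

theorem analyticAt_partialDeriv_slice (j : Fin m) {G : ℝ → Vec m → Cl m} {p : ℝ × Vec m}
    (hG : AnalyticAt ℝ (fun p : ℝ × Vec m => G p.1 p.2) p) :
    AnalyticAt ℝ (fun p : ℝ × Vec m => partialDeriv j (G p.1) p.2) p := by
  refine (analyticAt_fderiv_apply hG (0, EuclideanSpace.single j 1)).congr ?_
  filter_upwards [hG.eventually_analyticAt] with y hy
  exact (partialDeriv_slice j hy).symm

theorem analyticAt_deriv_time_slice {G : ℝ → Vec m → Cl m} {p : ℝ × Vec m}
    (hG : AnalyticAt ℝ (fun p : ℝ × Vec m => G p.1 p.2) p) :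
    AnalyticAt ℝ (fun p : ℝ × Vec m => deriv (fun v => G v p.2) p.1) p := by
  refine (analyticAt_fderiv_apply hG (1, 0)).congr ?_
  filter_upwards [hG.eventually_analyticAt] with y hy
  exact (deriv_time_slice hy).symm

theorem analyticAt_Gamma_slice {G : ℝ → Vec m → Cl m} {p : ℝ × Vec m}
    (hG : AnalyticAt ℝ (fun p : ℝ × Vec m => G p.1 p.2) p) :
    AnalyticAt ℝ (fun p : ℝ × Vec m => Gamma (G p.1) p.2) p := by
  have hsnd : AnalyticAt ℝ (fun p : ℝ × Vec m => p.2) p := analyticAt_snd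
  have hvec : AnalyticAt ℝ (fun p : ℝ × Vec m => vec p.2) p := by
    simp only [← vecL_apply]
    exact ((vecL m).analyticAt _).comp hsnd
  simp only [Gamma_eq]
  refine .fun_sub (.fun_neg (((clMul m).analyticAt_bilinear (_, _)).comp₂ hvec ?_)) ?_
  · exact Finset.analyticAt_fun_sum (f := fun j (p : ℝ × Vec m) => e j * partialDeriv j (G p.1) p.2)
      Finset.univ fun j _ => ((clMul m (e j)).analyticAt _).comp (analyticAt_partialDeriv_slice j hG)
  · exact Finset.analyticAt_fun_sum _ fun j _ =>
      (((EuclideanSpace.proj j : Vec m →L[ℝ] ℝ).analyticAt _).comp hsnd).fun_smul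
        (analyticAt_partialDeriv_slice j hG)

/-- The operator `Γ` commutes with the derivative in time. -/
theorem hasDerivAt_Gamma {G : ℝ → Vec m → Cl m} {u : ℝ} {x : Vec m}
    (hG : AnalyticAt ℝ (fun p : ℝ × Vec m => G p.1 p.2) (u, x)) :
    HasDerivAt (fun v => Gamma (G v) x) (Gamma (fun y => deriv (fun v => G v y) u) x) u := by
  -- Symmetry of the joint second derivative in $(u,x)$ exchanges $\partial_u$ with each
  -- $\partial_{x_j}$; the coefficients of $\Gamma$ do not involve $u$.
  have hsymm : IsSymmSndFDerivAt ℝ (fun p : ℝ × Vec m => G p.1 p.2) (u, x) :=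
    hG.contDiffAt (n := 2) |>.isSymmSndFDerivAt (by simp)
  have h2 : ∀ v w : ℝ × Vec m, fderiv ℝ (fun p => fderiv ℝ (fun p : ℝ × Vec m => G p.1 p.2) p v)
      (u, x) w = fderiv ℝ (fderiv ℝ (fun p : ℝ × Vec m => G p.1 p.2)) (u, x) w v := by
    intro v w
    rw [(hG.fderiv.differentiableAt.hasFDerivAt.clm_apply (hasFDerivAt_const v (u, x))).fderiv]
    simp
  have key : ∀ j, HasDerivAt (fun v => partialDeriv j (G v) x)
      (partialDeriv j (fun y => deriv (fun v => G v y) u) x) u := by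
    intro j
    have e1 : partialDeriv j (fun y => deriv (fun v => G v y) u) x =
        fderiv ℝ (fderiv ℝ (fun p : ℝ × Vec m => G p.1 p.2)) (u, x)
          (0, EuclideanSpace.single j 1) (1, 0) := by
      rw [partialDeriv_slice j (G := fun u y => deriv (fun v => G v y) u) (p := (u, x))
        (analyticAt_deriv_time_slice hG), ← h2]
      congr 1
      refine Filter.EventuallyEq.fderiv_eq ?_
      filter_upwards [hG.eventually_analyticAt] with y hy
      exact deriv_time_slice hy
    have e2 : deriv (fun v => partialDeriv j (G v) x) u =
        fderiv ℝ (fderiv ℝ (fun p : ℝ × Vec m => G p.1 p.2)) (u, x)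
          (1, 0) (0, EuclideanSpace.single j 1) := by
      rw [deriv_time_slice (G := fun u y => partialDeriv j (G u) y) (p := (u, x))
        (analyticAt_partialDeriv_slice j hG), ← h2]
      congr 1
      refine Filter.EventuallyEq.fderiv_eq ?_
      filter_upwards [hG.eventually_analyticAt] with y hy
      exact partialDeriv_slice j hy
    rw [e1, ← hsymm, ← e2]
    exact (analyticAt_time_slice (G := fun v y => partialDeriv j (G v) y)
      (analyticAt_partialDeriv_slice j hG)).differentiableAt.hasDerivAt
  simp only [Gamma_eq]
  refine .fun_sub (.fun_neg ?_) ?_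
  · exact (clMul m (vec x)).hasFDerivAt.comp_hasDerivAt u
      (HasDerivAt.fun_sum fun j _ => (clMul m (e j)).hasFDerivAt.comp_hasDerivAt u (key j))
  · exact HasDerivAt.fun_sum fun j _ => (key j).const_smul (x j)

theorem hasDerivAt_mul {f g : ℝ → Cl m} {f' g' : Cl m} {u : ℝ} (hf : HasDerivAt f f' u)
    (hg : HasDerivAt g g' u) : HasDerivAt (fun v => f v * g v) (f' * g u + f u * g') u := by
  have := (clMul m).hasDerivAt_of_bilinear (fun _ => hf) (fun _ => hg)
  rw [add_comm]
  exact this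

theorem hasDerivAt_comp_const_sub {F : Type*} [NormedAddCommGroup F] [NormedSpace ℝ F]
    {f : ℝ → F} {f' : F} {a s : ℝ}
    (hf : HasDerivAt f f' (a - s)) : HasDerivAt (fun s => f (a - s)) (-f') s :=
  HasDerivAt.comp_const_sub a s hf

end TimeDependent

/-! ### The wave equation on a sphere -/

section Wave

variable {m : ℕ}

theorem analyticAt_casimir_slice {G : ℝ → Vec m → Cl m} {p : ℝ × Vec m}
    (hG : AnalyticAt ℝ (fun p : ℝ × Vec m => G p.1 p.2) p) :
    AnalyticAt ℝ (fun p : ℝ × Vec m => casimir (G p.1) p.2) p :=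
  (analyticAt_Gamma_slice (G := fun u => Gamma (G u)) (analyticAt_Gamma_slice hG)).fun_sub
    (analyticAt_const.fun_smul (analyticAt_Gamma_slice hG))

/-- `W` and its time derivative `Z` form a solution of the wave equation
`∂_u² W = (Γ² - (m - 2) Γ + κ) W` for times between `l` and `0`, on the sphere of radius `r`. -/
structure IsSphericalWave (l r κ : ℝ) (W Z : ℝ → Vec m → Cl m) : Prop where
  analytic_left : AnalyticOnNhd ℝ (fun p : ℝ × Vec m => W p.1 p.2)
    (Set.Icc l 0 ×ˢ Metric.sphere 0 r)
  analytic_right : AnalyticOnNhd ℝ (fun p : ℝ × Vec m => Z p.1 p.2)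
    (Set.Icc l 0 ×ˢ Metric.sphere 0 r)
  deriv_left : ∀ u ∈ Set.Icc l 0, ∀ x ∈ Metric.sphere (0 : Vec m) r,
    HasDerivAt (fun v => W v x) (Z u x) u
  deriv_right : ∀ u ∈ Set.Icc l 0, ∀ x ∈ Metric.sphere (0 : Vec m) r,
    HasDerivAt (fun v => Z v x) (casimir (W u) x + κ • W u x) u
  initial : ∀ x ∈ Metric.sphere (0 : Vec m) r, Z 0 x = 0

theorem continuousOn_comp_sphere {F : Type*} [TopologicalSpace F] {l r : ℝ} (hr : 0 ≤ r)
    {A : ℝ → Vec m → F}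
    (hA : ContinuousOn (fun p : ℝ × Vec m => A p.1 p.2) (Set.Icc l 0 ×ˢ Metric.sphere 0 r))
    {h : ℝ → ℝ} (hh : Continuous h) {s : Set ℝ} (hs : ∀ v ∈ s, h v ∈ Set.Icc l 0) :
    ContinuousOn (fun p : ℝ × Metric.sphere (0 : Vec m) 1 => A (h p.1) (r • (p.2 : Vec m)))
      (s ×ˢ Set.univ) :=
  hA.comp (f := fun p : ℝ × Metric.sphere (0 : Vec m) 1 => (h p.1, r • (p.2 : Vec m)))
    (by fun_prop) fun p hp => ⟨hs _ hp.1, smul_mem_sphere hr _⟩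

/-- The integral of $Z(s)W'(u-s)+W(s)Z'(u-s)$ is independent of $s$: the products $ZZ'$ and the
$\kappa$ terms cancel, and the rest vanishes by the symmetry of `casimir`. At $s=0$ and $s=u$ the
vanishing initial velocities leave the two sides. -/
theorem IsSphericalWave.sphereIntegral_deriv {l r κ : ℝ} (hr : 0 ≤ r) {W Z W' Z' : ℝ → Vec m → Cl m}
    (h : IsSphericalWave l r κ W Z) (h' : IsSphericalWave l r κ W' Z') {u : ℝ}
    (hu : u ∈ Set.Icc l 0) :
    sphereIntegral r (fun x => W 0 x * Z' u x) = sphereIntegral r (fun x => Z u x * W' 0 x) := by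
  have hui : Set.uIcc 0 u = Set.Icc u 0 := Set.uIcc_of_ge hu.2
  have m1 : ∀ s ∈ Set.Icc u 0, s ∈ Set.Icc l 0 := fun s hs => ⟨hu.1.trans hs.1, hs.2⟩
  have m2 : ∀ s ∈ Set.Icc u 0, u - s ∈ Set.Icc l 0 := fun s hs =>
    ⟨by linarith [hs.2, hu.1], by linarith [hs.1]⟩
  have hsl : ∀ {A : ℝ → Vec m → Cl m}, AnalyticOnNhd ℝ (fun p : ℝ × Vec m => A p.1 p.2)
      (Set.Icc l 0 ×ˢ Metric.sphere 0 r) → ∀ s ∈ Set.Icc l 0,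
      AnalyticOnNhd ℝ (A s) (Metric.sphere 0 r) := fun hA s hs x hx =>
    analyticAt_slice (hA (s, x) ⟨hs, hx⟩)
  have hcas : ∀ {A : ℝ → Vec m → Cl m}, AnalyticOnNhd ℝ (fun p : ℝ × Vec m => A p.1 p.2)
      (Set.Icc l 0 ×ˢ Metric.sphere 0 r) → AnalyticOnNhd ℝ
      (fun p : ℝ × Vec m => casimir (A p.1) p.2) (Set.Icc l 0 ×ˢ Metric.sphere 0 r) :=
    fun hA p hp => analyticAt_casimir_slice (hA p hp)
  have key := integral_sub_integral_eq_intervalIntegral_deriv (m := m) (a := 0) (b := u)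
    (Φ := fun s ξ => Z s (r • (ξ : Vec m)) * W' (u - s) (r • (ξ : Vec m))
      + W s (r • (ξ : Vec m)) * Z' (u - s) (r • (ξ : Vec m)))
    (Φ' := fun s ξ => casimir (W s) (r • (ξ : Vec m)) * W' (u - s) (r • (ξ : Vec m))
      - W s (r • (ξ : Vec m)) * casimir (W' (u - s)) (r • (ξ : Vec m))) ?_ ?_ ?_
  · have hz : ∀ s ∈ Set.Icc u 0, (∫ ξ : Metric.sphere (0 : Vec m) 1,
        (casimir (W s) (r • (ξ : Vec m)) * W' (u - s) (r • (ξ : Vec m))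
          - W s (r • (ξ : Vec m)) * casimir (W' (u - s)) (r • (ξ : Vec m)))
        ∂(volume : Measure (Vec m)).toSphere) = 0 := by
      intro s hs
      have a1 := hsl h.analytic_left s (m1 s hs)
      have a2 := hsl h'.analytic_left _ (m2 s hs)
      have a3 := hsl (A := fun u => casimir (W u)) (hcas h.analytic_left) s (m1 s hs)
      have a4 := hsl (A := fun u => casimir (W' u)) (hcas h'.analytic_left) _ (m2 s hs)
      have := sphereIntegral_sub hr
        (φ := fun x => casimir (W s) x * W' (u - s) x) (ψ := fun x => W s x * casimir (W' (u - s)) x)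
        (fun x hx => (analyticAt_mul (a3 x hx) (a2 x hx)).continuousAt.continuousWithinAt)
        (fun x hx => (analyticAt_mul (a1 x hx) (a4 x hx)).continuousAt.continuousWithinAt)
      rw [← sphereIntegral_mul_casimir hr a1 a2, sub_self] at this
      exact this
    rw [intervalIntegral.integral_congr (g := fun _ => 0) (fun s hs => hz s (hui ▸ hs)),
      intervalIntegral.integral_zero, sub_eq_zero] at key
    simp only [sub_self, sub_zero] at key
    have e1 : sphereIntegral r (fun x => Z u x * W' 0 x + W u x * Z' 0 x) =
        sphereIntegral r (fun x => Z u x * W' 0 x) :=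
      sphereIntegral_congr hr fun x hx => by rw [h'.initial x hx, mul_zero, add_zero]
    have e2 : sphereIntegral r (fun x => Z 0 x * W' u x + W 0 x * Z' u x) =
        sphereIntegral r (fun x => W 0 x * Z' u x) :=
      sphereIntegral_congr hr fun x hx => by rw [h.initial x hx, zero_mul, zero_add]
    rw [← e1, ← e2]
    exact key.symm
  · intro s hs ξ
    rw [hui] at hs
    have hx := smul_mem_sphere hr ξ
    have d1 := hasDerivAt_mul (h.deriv_right s (m1 s hs) _ hx)
      (hasDerivAt_comp_const_sub (h'.deriv_left _ (m2 s hs) _ hx))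
    have d2 := hasDerivAt_mul (h.deriv_left s (m1 s hs) _ hx)
      (hasDerivAt_comp_const_sub (h'.deriv_right _ (m2 s hs) _ hx))
    refine (d1.add d2).congr_deriv ?_
    simp only [add_mul, mul_add, mul_neg, neg_add, smul_mul_assoc, mul_smul_comm]
    abel
  · intro s hs
    rw [hui] at hs
    refine continuous_smul_sphere hr (φ := fun x => Z s x * W' (u - s) x + W s x * Z' (u - s) x) ?_
    intro x hx
    exact ((analyticAt_mul (hsl h.analytic_right s (m1 s hs) x hx)
      (hsl h'.analytic_left _ (m2 s hs) x hx)).add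
      (analyticAt_mul (hsl h.analytic_left s (m1 s hs) x hx)
      (hsl h'.analytic_right _ (m2 s hs) x hx))).continuousAt.continuousWithinAt
  · rw [hui]
    have c1 := continuousOn_comp_sphere hr h.analytic_left.continuousOn continuous_id m1
    have c2 := continuousOn_comp_sphere hr h'.analytic_left.continuousOn (by fun_prop) m2
    have c3 := continuousOn_comp_sphere hr (A := fun u => casimir (W u))
      (hcas h.analytic_left).continuousOn continuous_id m1
    have c4 := continuousOn_comp_sphere hr (A := fun u => casimir (W' u))
      (hcas h'.analytic_left).continuousOn (by fun_prop) m2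
    exact (continuous_clMul.comp_continuousOn (c3.prodMk c2)).sub
      (continuous_clMul.comp_continuousOn (c1.prodMk c4))

/-- The solution operator of the wave equation is symmetric for the product of the Clifford
algebra. -/
theorem IsSphericalWave.sphereIntegral_eq {l r κ : ℝ} (hl : l ≤ 0) (hr : 0 ≤ r)
    {W Z W' Z' : ℝ → Vec m → Cl m}
    (h : IsSphericalWave l r κ W Z) (h' : IsSphericalWave l r κ W' Z') :
    sphereIntegral r (fun x => W 0 x * W' l x) = sphereIntegral r (fun x => W l x * W' 0 x) := by
  have hui : Set.uIcc 0 l = Set.Icc l 0 := Set.uIcc_of_ge hl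
  have h0 : (0 : ℝ) ∈ Set.Icc l 0 := ⟨hl, le_rfl⟩
  have hlm : l ∈ Set.Icc l 0 := ⟨le_rfl, hl⟩
  have hsl : ∀ {A : ℝ → Vec m → Cl m}, AnalyticOnNhd ℝ (fun p : ℝ × Vec m => A p.1 p.2)
      (Set.Icc l 0 ×ˢ Metric.sphere 0 r) → ∀ s ∈ Set.Icc l 0,
      AnalyticOnNhd ℝ (A s) (Metric.sphere 0 r) := fun hA s hs x hx =>
    analyticAt_slice (hA (s, x) ⟨hs, hx⟩)
  have hmul : ∀ {f g : Vec m → Cl m}, AnalyticOnNhd ℝ f (Metric.sphere 0 r) →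
      AnalyticOnNhd ℝ g (Metric.sphere 0 r) →
      ContinuousOn (fun y => f y * g y) (Metric.sphere 0 r) := fun hf hg x hx =>
    (analyticAt_mul (hf x hx) (hg x hx)).continuousAt.continuousWithinAt
  -- The difference of the two sides vanishes at time $0$, and its time derivative vanishes by
  -- `sphereIntegral_deriv`.
  have key := integral_sub_integral_eq_intervalIntegral_deriv (m := m) (a := 0) (b := l)
    (Φ := fun s ξ => W 0 (r • (ξ : Vec m)) * W' s (r • (ξ : Vec m))
      - W s (r • (ξ : Vec m)) * W' 0 (r • (ξ : Vec m)))
    (Φ' := fun s ξ => W 0 (r • (ξ : Vec m)) * Z' s (r • (ξ : Vec m))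
      - Z s (r • (ξ : Vec m)) * W' 0 (r • (ξ : Vec m))) ?_ ?_ ?_
  · have hz : ∀ s ∈ Set.Icc l 0, (∫ ξ : Metric.sphere (0 : Vec m) 1,
        (W 0 (r • (ξ : Vec m)) * Z' s (r • (ξ : Vec m))
          - Z s (r • (ξ : Vec m)) * W' 0 (r • (ξ : Vec m)))
        ∂(volume : Measure (Vec m)).toSphere) = 0 := by
      intro s hs
      have := sphereIntegral_sub hr
        (hmul (hsl h.analytic_left 0 h0) (hsl h'.analytic_right s hs))
        (hmul (hsl h.analytic_right s hs) (hsl h'.analytic_left 0 h0))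
      rw [h.sphereIntegral_deriv hr h' hs, sub_self] at this
      exact this
    rw [intervalIntegral.integral_congr (g := fun _ => 0) (fun s hs => hz s (hui ▸ hs)),
      intervalIntegral.integral_zero, sub_eq_zero] at key
    simp only [sub_self, integral_zero] at key
    have := sphereIntegral_sub hr
      (hmul (hsl h.analytic_left 0 h0) (hsl h'.analytic_left l hlm))
      (hmul (hsl h.analytic_left l hlm) (hsl h'.analytic_left 0 h0))
    exact sub_eq_zero.mp (this.symm.trans key)
  · intro s hs ξ
    rw [hui] at hs
    have hx := smul_mem_sphere hr ξ
    have d1 := hasDerivAt_mul (hasDerivAt_const s (W 0 (r • (ξ : Vec m))))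
      (h'.deriv_left s hs _ hx)
    have d2 := hasDerivAt_mul (h.deriv_left s hs _ hx)
      (hasDerivAt_const s (W' 0 (r • (ξ : Vec m))))
    refine (d1.fun_sub d2).congr_deriv ?_
    simp
  · intro s hs
    rw [hui] at hs
    exact continuous_smul_sphere hr (φ := fun x => W 0 x * W' s x - W s x * W' 0 x)
      ((hmul (hsl h.analytic_left 0 h0) (hsl h'.analytic_left s hs)).sub
        (hmul (hsl h.analytic_left s hs) (hsl h'.analytic_left 0 h0)))
  · rw [hui]
    have c1 := continuousOn_comp_sphere hr h.analytic_left.continuousOn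
      (h := fun _ => 0) (s := Set.Icc l 0) continuous_const (fun _ _ => h0)
    have c2 := continuousOn_comp_sphere hr h'.analytic_right.continuousOn continuous_id
      (s := Set.Icc l 0) (fun _ h => h)
    have c3 := continuousOn_comp_sphere hr h.analytic_right.continuousOn continuous_id
      (s := Set.Icc l 0) (fun _ h => h)
    have c4 := continuousOn_comp_sphere hr h'.analytic_left.continuousOn
      (h := fun _ => 0) (s := Set.Icc l 0) continuous_const (fun _ _ => h0)
    exact (continuous_clMul.comp_continuousOn (c1.prodMk c2)).sub
      (continuous_clMul.comp_continuousOn (c3.prodMk c4))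

end Wave

/-! ### Backward uniqueness for the flow of $\Gamma$ -/

section BackwardUniqueness

variable {m : ℕ}

/-- There is an inner product on the Clifford algebra for which the bivectors are skew. -/
theorem exists_inner_bivector_skew (m : ℕ) : ∃ B : Cl m →L[ℝ] Cl m →L[ℝ] ℝ,
    (∀ a, a ≠ 0 → 0 < B a a) ∧
      ∀ i j : Fin m, i ≠ j → ∀ a b, B (e i * e j * a) b = -B a (e i * e j * b) := by
  have key : ∀ s : Finset (Fin m), ∃ B : Cl m →ₗ[ℝ] Cl m →ₗ[ℝ] ℝ,
      (∀ a, a ≠ 0 → 0 < B a a) ∧ ∀ i ∈ s, ∀ a b, B (e i * a) (e i * b) = B a b := by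
    intro s
    induction s using Finset.induction_on with
    | empty =>
      refine ⟨(innerₗ (EuclideanSpace ℝ (Finset (Fin m)))).compl₁₂ (clCoord m).toLinearMap
        (clCoord m).toLinearMap, fun a ha => ?_, by simp⟩
      have : clCoord m a ≠ 0 := by simpa using ha
      simpa using real_inner_self_pos.mpr this
    | insert k s _ ih =>
      obtain ⟨B, hpos, hinv⟩ := ih
      -- Averaging over left multiplication by $e_k$: since $e_k^2=-1$ the two summands are
      -- exchanged by $e_k$, and since $e_k$ anticommutes with the earlier generators their
      -- invariance persists, the two signs cancelling.
      refine ⟨B + B.compl₁₂ (LinearMap.mulLeft ℝ (e k)) (LinearMap.mulLeft ℝ (e k)), ?_, ?_⟩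
      · intro a ha
        have hk : e k * a ≠ 0 := by
          intro h
          have : e k * (e k * a) = 0 := by rw [h, mul_zero]
          rw [← mul_assoc, e_mul_e_self] at this
          exact ha (by simpa using this)
        have := add_pos (hpos a ha) (hpos _ hk)
        simpa using this
      · intro i hi a b
        simp only [LinearMap.add_apply, LinearMap.compl₁₂_apply, LinearMap.mulLeft_apply]
        rcases eq_or_ne i k with rfl | hik
        · simp only [← mul_assoc, e_mul_e_self]
          simp [add_comm]
        · have his : i ∈ s := (Finset.mem_insert.mp hi).resolve_left hik
          simp only [← mul_assoc, e_mul_e_comm hik.symm]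
          simp only [neg_mul, map_neg, LinearMap.neg_apply, neg_neg, mul_assoc, hinv i his]
  obtain ⟨B, hpos, hinv⟩ := key Finset.univ
  refine ⟨B.toContinuousBilinearMap, hpos, fun i j hij a b => ?_⟩
  simp only [LinearMap.toContinuousBilinearMap_apply]
  have h1 : e i * (e i * e j * a) = -(e j * a) := by
    rw [← mul_assoc, ← mul_assoc, e_mul_e_self]
    simp
  have h2 : e j * (e i * e j * b) = e i * b := by
    rw [← mul_assoc, ← mul_assoc, e_mul_e_comm hij.symm, neg_mul, mul_assoc (e i), e_mul_e_self]
    simp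
  -- Both sides become $-B(e_ja,e_ib)$.
  rw [← hinv i (Finset.mem_univ i) (e i * e j * a) b, ← hinv j (Finset.mem_univ j) a, h1, h2]
  simp

/-- The bivectors are skew for `B` and the angular derivatives are skew for integration over the
sphere, so their products are symmetric. -/
theorem sphereIntegral_inner_Gamma {B : Cl m →L[ℝ] Cl m →L[ℝ] ℝ}
    (hB : ∀ i j : Fin m, i ≠ j → ∀ a b, B (e i * e j * a) b = -B a (e i * e j * b))
    {r : ℝ} (hr : 0 ≤ r) {f g : Vec m → Cl m}
    (hf : AnalyticOnNhd ℝ f (Metric.sphere 0 r)) (hg : AnalyticOnNhd ℝ g (Metric.sphere 0 r)) :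
    sphereIntegral r (fun x => B (f x) (Gamma g x)) =
      sphereIntegral r (fun x => B (Gamma f x) (g x)) := by
  refine sphereIntegral_bilinear_Gamma B B Gamma hr ?_ hf hg
  intro x _ b
  rw [Gamma_eq_angularDeriv]
  simp only [map_neg, map_sum, neg_apply, sum_apply, ← Finset.sum_neg_distrib]
  refine Finset.sum_congr rfl fun i _ => Finset.sum_congr rfl fun j _ => ?_
  split_ifs with hij
  · rw [hB i j hij.ne, neg_neg]
  · simp

/-- For symmetric $\Gamma$ the integral of $B(G(u/2+s),G(u/2-s))$ is independent of $s$. At $s=u/2$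
it pairs $G(u)=0$ with $G(0)$; at $s=0$ it is the squared norm of $G(u/2)$. -/
theorem flow_half_eq_zero {l r : ℝ} (hr : 0 < r) {G : ℝ → Vec m → Cl m}
    (hG : AnalyticOnNhd ℝ (fun p : ℝ × Vec m => G p.1 p.2) (Set.Icc l 0 ×ˢ Metric.sphere 0 r))
    (hd : ∀ u ∈ Set.Icc l 0, ∀ x ∈ Metric.sphere (0 : Vec m) r,
      HasDerivAt (fun v => G v x) (Gamma (G u) x) u) {u : ℝ} (hu : u ∈ Set.Icc l 0)
    (h0 : ∀ x ∈ Metric.sphere (0 : Vec m) r, G u x = 0) :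
    ∀ x ∈ Metric.sphere (0 : Vec m) r, G (u / 2) x = 0 := by
  obtain ⟨B, hpos, hB⟩ := exists_inner_bivector_skew m
  have hui : Set.uIcc 0 (u / 2) = Set.Icc (u / 2) 0 := Set.uIcc_of_ge (by linarith [hu.2])
  have m1 : ∀ s ∈ Set.Icc (u / 2) 0, u / 2 + s ∈ Set.Icc l 0 := fun s hs =>
    ⟨by linarith [hu.1, hs.1], by linarith [hu.2, hs.2]⟩
  have m2 : ∀ s ∈ Set.Icc (u / 2) 0, u / 2 - s ∈ Set.Icc l 0 := fun s hs =>
    ⟨by linarith [hu.1, hu.2, hs.2], by linarith [hs.1]⟩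
  have hsl : ∀ s ∈ Set.Icc l 0, AnalyticOnNhd ℝ (G s) (Metric.sphere 0 r) := fun s hs x hx =>
    analyticAt_slice (hG (s, x) ⟨hs, hx⟩)
  have hΓ : AnalyticOnNhd ℝ (fun p : ℝ × Vec m => Gamma (G p.1) p.2)
      (Set.Icc l 0 ×ˢ Metric.sphere 0 r) := fun p hp => analyticAt_Gamma_slice (hG p hp)
  have hmul : ∀ {f g : Vec m → Cl m}, AnalyticOnNhd ℝ f (Metric.sphere 0 r) →
      AnalyticOnNhd ℝ g (Metric.sphere 0 r) →
      ContinuousOn (fun y => B (f y) (g y)) (Metric.sphere 0 r) := fun hf hg x hx =>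
    ((B.analyticAt_bilinear (_, _)).comp₂ (hf x hx) (hg x hx)).continuousAt.continuousWithinAt
  have key := integral_sub_integral_eq_intervalIntegral_deriv (m := m) (a := 0) (b := u / 2)
    (Φ := fun s ξ => B (G (u / 2 + s) (r • (ξ : Vec m))) (G (u / 2 - s) (r • (ξ : Vec m))))
    (Φ' := fun s ξ =>
      B (Gamma (G (u / 2 + s)) (r • (ξ : Vec m))) (G (u / 2 - s) (r • (ξ : Vec m)))
      - B (G (u / 2 + s) (r • (ξ : Vec m))) (Gamma (G (u / 2 - s)) (r • (ξ : Vec m)))) ?_ ?_ ?_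
  · have hz : ∀ s ∈ Set.Icc (u / 2) 0, (∫ ξ : Metric.sphere (0 : Vec m) 1,
        (B (Gamma (G (u / 2 + s)) (r • (ξ : Vec m))) (G (u / 2 - s) (r • (ξ : Vec m)))
          - B (G (u / 2 + s) (r • (ξ : Vec m))) (Gamma (G (u / 2 - s)) (r • (ξ : Vec m))))
        ∂(volume : Measure (Vec m)).toSphere) = 0 := by
      intro s hs
      have a1 := hsl _ (m1 s hs)
      have a2 := hsl _ (m2 s hs)
      have := sphereIntegral_sub hr.le
        (hmul (fun x hx => analyticAt_Gamma (a1 x hx)) a2)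
        (hmul a1 (fun x hx => analyticAt_Gamma (a2 x hx)))
      rw [sphereIntegral_inner_Gamma hB hr.le a1 a2, sub_self] at this
      exact this
    rw [intervalIntegral.integral_congr (g := fun _ => 0) (fun s hs => hz s (hui ▸ hs)),
      intervalIntegral.integral_zero, sub_eq_zero] at key
    simp only [add_zero, sub_zero, sub_self, add_halves] at key
    have hz0 : (∫ ξ : Metric.sphere (0 : Vec m) 1, B (G u (r • (ξ : Vec m)))
        (G 0 (r • (ξ : Vec m))) ∂(volume : Measure (Vec m)).toSphere) = 0 := by
      simp [h0 _ (smul_mem_sphere hr.le _)]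
    rw [hz0] at key
    have hmid : u / 2 ∈ Set.Icc l 0 := ⟨by linarith [hu.1, hu.2], by linarith [hu.2]⟩
    have hcont := continuous_smul_sphere hr.le (hmul (hsl _ hmid) (hsl _ hmid))
    have hnn : ∀ a, 0 ≤ B a a := fun a => by
      rcases eq_or_ne a 0 with rfl | ha
      · simp
      · exact (hpos a ha).le
    have hae := (integral_eq_zero_iff_of_nonneg (fun ξ => hnn _) (integrable_sphere hcont)).mp
      key.symm
    have heq := (hcont.ae_eq_iff_eq _ continuous_const).mp hae
    have hall : ∀ ξ : Metric.sphere (0 : Vec m) 1, G (u / 2) (r • (ξ : Vec m)) = 0 := by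
      intro ξ
      by_contra hne
      exact (hpos _ hne).ne' (congrFun heq ξ)
    intro x hx
    rw [mem_sphere_zero_iff_norm] at hx
    have hξ : r⁻¹ • x ∈ Metric.sphere (0 : Vec m) 1 := by
      rw [mem_sphere_zero_iff_norm, norm_smul, hx, Real.norm_eq_abs, abs_of_pos (inv_pos.mpr hr),
        inv_mul_cancel₀ hr.ne']
    simpa [smul_smul, hr.ne'] using hall ⟨_, hξ⟩
  · intro s hs ξ
    rw [hui] at hs
    have hx := smul_mem_sphere hr.le ξ
    have d1 : HasDerivAt (fun s => G (u / 2 + s) (r • (ξ : Vec m))) _ s :=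
      HasDerivAt.comp_const_add (u / 2) s (hd _ (m1 s hs) _ hx)
    have d2 := hasDerivAt_comp_const_sub (hd _ (m2 s hs) _ hx)
    refine (B.hasDerivAt_of_bilinear (fun _ => d1) (fun _ => d2)).congr_deriv ?_
    rw [map_neg]
    abel
  · intro s hs
    rw [hui] at hs
    exact continuous_smul_sphere hr.le (hmul (hsl _ (m1 s hs)) (hsl _ (m2 s hs)))
  · rw [hui]
    have c1 := continuousOn_comp_sphere hr.le (A := G) hG.continuousOn (by fun_prop) m1
    have c2 := continuousOn_comp_sphere hr.le (A := G) hG.continuousOn (by fun_prop) m2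
    have c3 := continuousOn_comp_sphere hr.le (A := fun u => Gamma (G u)) hΓ.continuousOn
      (by fun_prop) m1
    have c4 := continuousOn_comp_sphere hr.le (A := fun u => Gamma (G u)) hΓ.continuousOn
      (by fun_prop) m2
    exact (B.continuous₂.comp_continuousOn (c3.prodMk c2)).sub
      (B.continuous₂.comp_continuousOn (c1.prodMk c4))

/-- A solution of `∂_u G = Γ G` on a sphere that vanishes at the time `l` vanishes at time `0`. -/
theorem flow_backward_unique {l r : ℝ} (hl : l ≤ 0) (hr : 0 < r) {G : ℝ → Vec m → Cl m}
    (hG : AnalyticOnNhd ℝ (fun p : ℝ × Vec m => G p.1 p.2) (Set.Icc l 0 ×ˢ Metric.sphere 0 r))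
    (hd : ∀ u ∈ Set.Icc l 0, ∀ x ∈ Metric.sphere (0 : Vec m) r,
      HasDerivAt (fun v => G v x) (Gamma (G u) x) u)
    (h0 : ∀ x ∈ Metric.sphere (0 : Vec m) r, G l x = 0) :
    ∀ x ∈ Metric.sphere (0 : Vec m) r, G 0 x = 0 := by
  have hmem : ∀ n : ℕ, l / 2 ^ n ∈ Set.Icc l 0 := by
    intro n
    have h1 : (1 : ℝ) ≤ 2 ^ n := one_le_pow₀ one_le_two
    constructor
    · rw [le_div_iff₀ (by positivity)]
      nlinarith
    · exact div_nonpos_of_nonpos_of_nonneg hl (by positivity)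
  -- Repeated halving carries the zero along times tending to $0$; continuity in time does the rest.
  have hn : ∀ n : ℕ, ∀ x ∈ Metric.sphere (0 : Vec m) r, G (l / 2 ^ n) x = 0 := by
    intro n
    induction n with
    | zero => simpa using h0
    | succ n ih =>
      have := flow_half_eq_zero hr hG hd (hmem n) ih
      rwa [div_div, ← pow_succ] at this
  intro x hx
  have hlim : Tendsto (fun n : ℕ => l / 2 ^ n) atTop (𝓝 0) :=
    tendsto_const_nhds.div_atTop (tendsto_pow_atTop_atTop_of_one_lt one_lt_two)
  have hc := (hd 0 ⟨hl, le_rfl⟩ x hx).continuousAt.tendsto.comp hlim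
  refine tendsto_nhds_unique hc ?_
  simp only [Function.comp_def, hn _ x hx]
  exact tendsto_const_nhds

end BackwardUniqueness

/-! ### From a forward and a backward flow to a wave -/

section WaveOfFlows

variable {m : ℕ}

theorem Gamma_sub {f g : Vec m → Cl m} {x : Vec m} (hf : DifferentiableAt ℝ f x)
    (hg : DifferentiableAt ℝ g x) : Gamma (fun y => f y - g y) x = Gamma f x - Gamma g x := by
  have h := Gamma_add hf (hg.fun_const_smul (-1 : ℝ))
  rw [Gamma_const_smul (-1) hg] at h
  simpa only [neg_one_smul, ← sub_eq_add_neg] using h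

theorem Gamma_zero (x : Vec m) : Gamma (fun _ => (0 : Cl m)) x = 0 := by
  simp [Gamma, partialDeriv]

/-- The sum of the solutions of the forward and the backward equation for `Γ - c` solves the wave
equation. -/
theorem isSphericalWave_of_flows {l r c : ℝ} (hc : 2 * c = (m : ℝ) - 2) (hl : l ≤ 0)
    {a b : ℝ → Vec m → Cl m}
    (ha : AnalyticOnNhd ℝ (fun p : ℝ × Vec m => a p.1 p.2) (Set.Icc l 0 ×ˢ Metric.sphere 0 r))
    (hb : AnalyticOnNhd ℝ (fun p : ℝ × Vec m => b p.1 p.2) (Set.Icc l 0 ×ˢ Metric.sphere 0 r))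
    (hda : ∀ u ∈ Set.Icc l 0, ∀ x ∈ Metric.sphere (0 : Vec m) r,
      HasDerivAt (fun v => a v x) (Gamma (a u) x - c • a u x) u)
    (hdb : ∀ u ∈ Set.Icc l 0, ∀ x ∈ Metric.sphere (0 : Vec m) r,
      HasDerivAt (fun v => b v x) (-(Gamma (b u) x - c • b u x)) u)
    (hab : ∀ x ∈ Metric.sphere (0 : Vec m) r, a 0 x = b 0 x) :
    IsSphericalWave l r (c ^ 2) (fun u x => a u x + b u x)
      (fun u x => Gamma (fun y => a u y - b u y) x - c • (a u x - b u x)) := by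
  have hV : ∀ p ∈ Set.Icc l 0 ×ˢ Metric.sphere (0 : Vec m) r,
      AnalyticAt ℝ (fun p : ℝ × Vec m => a p.1 p.2 - b p.1 p.2) p := fun p hp =>
    (ha p hp).fun_sub (hb p hp)
  have hW : ∀ p ∈ Set.Icc l 0 ×ˢ Metric.sphere (0 : Vec m) r,
      AnalyticAt ℝ (fun p : ℝ × Vec m => a p.1 p.2 + b p.1 p.2) p := fun p hp =>
    (ha p hp).fun_add (hb p hp)
  have hda' : ∀ u ∈ Set.Icc l 0, ∀ x ∈ Metric.sphere (0 : Vec m) r, DifferentiableAt ℝ (a u) x :=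
    fun u hu x hx => (analyticAt_slice (ha (u, x) ⟨hu, hx⟩)).differentiableAt
  have hdb' : ∀ u ∈ Set.Icc l 0, ∀ x ∈ Metric.sphere (0 : Vec m) r, DifferentiableAt ℝ (b u) x :=
    fun u hu x hx => (analyticAt_slice (hb (u, x) ⟨hu, hx⟩)).differentiableAt
  have hdV : ∀ u ∈ Set.Icc l 0, ∀ x ∈ Metric.sphere (0 : Vec m) r,
      HasDerivAt (fun v => a v x - b v x)
        (Gamma (fun y => a u y + b u y) x - c • (a u x + b u x)) u := by
    intro u hu x hx
    refine ((hda u hu x hx).fun_sub (hdb u hu x hx)).congr_deriv ?_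
    rw [Gamma_add (hda' u hu x hx) (hdb' u hu x hx)]
    module
  constructor
  · exact hW
  · intro p hp
    exact (analyticAt_Gamma_slice (G := fun u x => a u x - b u x) (hV p hp)).fun_sub
      (analyticAt_const.fun_smul (hV p hp))
  · intro u hu x hx
    refine ((hda u hu x hx).fun_add (hdb u hu x hx)).congr_deriv ?_
    rw [Gamma_sub (hda' u hu x hx) (hdb' u hu x hx)]
    module
  · intro u hu x hx
    have h1 := hasDerivAt_Gamma (G := fun u x => a u x - b u x) (hV (u, x) ⟨hu, hx⟩)
    have hWs : AnalyticAt ℝ (fun y => a u y + b u y) x :=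
      analyticAt_slice (G := fun u x => a u x + b u x) (hW (u, x) ⟨hu, hx⟩)
    -- The evolution equation holds only on the sphere, which suffices because $\Gamma$ is
    -- tangential.
    have h2 : Gamma (fun y => deriv (fun v => a v y - b v y) u) x =
        Gamma (fun y => Gamma (fun y => a u y + b u y) y - c • (a u y + b u y)) x := by
      refine Gamma_congr (fun y hy => (hdV u hu y hy).deriv) hx ?_ ?_
      · exact (analyticAt_slice (G := fun u y => deriv (fun v => a v y - b v y) u)
          (analyticAt_deriv_time_slice (G := fun u x => a u x - b u x)
            (hV (u, x) ⟨hu, hx⟩))).differentiableAt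
      · exact ((analyticAt_Gamma hWs).differentiableAt).fun_sub
          (hWs.differentiableAt.fun_const_smul c)
    have h3 := (analyticAt_Gamma hWs).differentiableAt
    rw [h2, Gamma_sub h3 (hWs.differentiableAt.fun_const_smul c),
      Gamma_const_smul c hWs.differentiableAt] at h1
    refine (h1.fun_sub ((hdV u hu x hx).fun_const_smul c)).congr_deriv ?_
    -- With $2c=m-2$ this is $(\Gamma-c)^2=\Gamma^2-(m-2)\Gamma+c^2$.
    rw [casimir, ← hc]
    module
  · intro x hx
    have h0 : (0 : ℝ) ∈ Set.Icc l 0 := ⟨hl, le_rfl⟩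
    have h1 : Gamma (fun y => a 0 y - b 0 y) x = Gamma (fun _ => (0 : Cl m)) x :=
      Gamma_congr (fun y hy => sub_eq_zero.mpr (hab y hy)) hx
        ((hda' 0 h0 x hx).fun_sub (hdb' 0 h0 x hx)) (differentiableAt_const _)
    rw [h1, Gamma_zero, hab x hx]
    simp

theorem hasDerivAt_exp_smul_flow {κ σ u : ℝ} {x : Vec m} {G : ℝ → Vec m → Cl m}
    (hG : DifferentiableAt ℝ (G u) x)
    (hd : HasDerivAt (fun v => G v x) (σ • Gamma (G u) x) u) :
    HasDerivAt (fun v => Real.exp (κ * v) • G v x)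
      (σ • Gamma (fun y => Real.exp (κ * u) • G u y) x + κ • Real.exp (κ * u) • G u x) u := by
  have h1 : HasDerivAt (fun v => Real.exp (κ * v)) (Real.exp (κ * u) * (κ * 1)) u :=
    ((hasDerivAt_id u).const_mul κ).exp
  refine (h1.smul hd).congr_deriv ?_
  rw [Gamma_const_smul _ hG]
  module

theorem analyticAt_exp_smul {κ : ℝ} {p : ℝ × Vec m} {G : ℝ → Vec m → Cl m}
    (hG : AnalyticAt ℝ (fun p : ℝ × Vec m => G p.1 p.2) p) :
    AnalyticAt ℝ (fun p : ℝ × Vec m => Real.exp (κ * p.1) • G p.1 p.2) p :=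
  (analyticAt_rexp.comp (analyticAt_const.fun_mul analyticAt_fst)).fun_smul hG

end WaveOfFlows

/-! ### The reverse flow $q^{-\Gamma}f$ and an explicit formula for $\Delta_q$ -/

section QFlows

variable {m : ℕ} {q R : ℝ}

theorem QGammaDefined.exists_flow {ρ : ℝ} {f : Vec m → Cl m} (h : QGammaDefined q ρ f) :
    ∃ G : ℝ → Vec m → Cl m, IsGammaFlow q ρ f G ∧ qGamma q ρ f = G (Real.log q) :=
  ⟨h.choose, h.choose_spec, by simp [qGamma, h]⟩

theorem qDirac_of_ne_zero {f : Vec m → Cl m} {x : Vec m} (hx : x ≠ 0) :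
    qDirac q R f x = vecInv x * (q - 1)⁻¹ • (qGamma q (q * R) f (q • x) - f x) := by
  rw [qDirac, if_neg hx, qEulerGamma]

/-- The solution of `∂_u K = -Γ K`, `K(0, ·) = f`, built from the solution `G` for `f` and the
solution `H` for `∂^q f`. -/
noncomputable def reverseFlow (q : ℝ) (G H : ℝ → Vec m → Cl m) (u : ℝ) (y : Vec m) : Cl m :=
  G (Real.log q - u) (q • y) -
    ((q - 1) * Real.exp (-((m : ℝ) - 1) * u)) • (vec y * H u y)

section

variable {f : Vec m → Cl m} {G H : ℝ → Vec m → Cl m} (hq0 : 0 < q) (hq1 : q < 1)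
  (hG : IsGammaFlow q (q * R) f G) (hGq : qGamma q (q * R) f = G (Real.log q))
  (hH : IsGammaFlow q (q * R) (qDirac q R f) H)
  (hHq : qGamma q (q * R) (qDirac q R f) = H (Real.log q))

include hq0 hq1 hG in
theorem analyticAt_reverseFlow_left {u : ℝ} (hu : u ∈ Set.Icc (Real.log q) 0) {y : Vec m}
    (hy : y ∈ Metric.closedBall 0 (q * R)) :
    AnalyticAt ℝ (fun p : ℝ × Vec m => G (Real.log q - p.1) (q • p.2)) (u, y) := by
  have hmem : (Real.log q - u, q • y) ∈
      Set.Icc (Real.log q) 0 ×ˢ Metric.closedBall (0 : Vec m) (q * R) := by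
    refine ⟨⟨by linarith [hu.2], by linarith [hu.1]⟩, ?_⟩
    rw [mem_closedBall_zero_iff] at hy ⊢
    rw [norm_smul, Real.norm_eq_abs, abs_of_pos hq0]
    nlinarith [norm_nonneg y]
  exact AnalyticAt.comp₂ (h := fun p : ℝ × Vec m => G p.1 p.2) (hG.1 _ hmem)
    (analyticAt_const.fun_sub analyticAt_fst) (analyticAt_const.fun_smul analyticAt_snd)

include hH in
theorem analyticAt_reverseFlow_right {u : ℝ} (hu : u ∈ Set.Icc (Real.log q) 0) {y : Vec m}
    (hy : y ∈ Metric.closedBall 0 (q * R)) :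
    AnalyticAt ℝ (fun p : ℝ × Vec m => vec p.2 * H p.1 p.2) (u, y) := by
  have hvec : AnalyticAt ℝ (fun p : ℝ × Vec m => vec p.2) (u, y) := by
    simp only [← vecL_apply]
    exact ((vecL m).analyticAt _).comp analyticAt_snd
  exact ((clMul m).analyticAt_bilinear (_, _)).comp₂ hvec (hH.1 _ ⟨hu, hy⟩)

include hq0 hq1 hG hH in
theorem analyticAt_reverseFlow {u : ℝ} (hu : u ∈ Set.Icc (Real.log q) 0) {y : Vec m}
    (hy : y ∈ Metric.closedBall 0 (q * R)) :
    AnalyticAt ℝ (fun p : ℝ × Vec m => reverseFlow q G H p.1 p.2) (u, y) := by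
  refine (analyticAt_reverseFlow_left hq0 hq1 hG hu hy).fun_sub (.fun_smul ?_
    (analyticAt_reverseFlow_right hH hu hy))
  exact analyticAt_const.fun_mul (analyticAt_rexp.comp
    (analyticAt_const.fun_mul analyticAt_fst))

-- In the first term reversing time changes the sign, and dilations commute with $\Gamma$. In the
-- second, $\Gamma\underline{x}=\underline{x}(m-1-\Gamma)$ makes $\underline{x}H$ evolve by
-- $m-1-\Gamma$; the factor $e^{-(m-1)u}$ removes the constant $m-1$.
include hq0 hq1 hG hH in
theorem hasDerivAt_reverseFlow {u : ℝ} (hu : u ∈ Set.Icc (Real.log q) 0) {y : Vec m}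
    (hy : y ∈ Metric.closedBall 0 (q * R)) :
    HasDerivAt (fun v => reverseFlow q G H v y) (-Gamma (reverseFlow q G H u) y) u := by
  have hmem : Real.log q - u ∈ Set.Icc (Real.log q) 0 :=
    ⟨by linarith [hu.2], by linarith [hu.1]⟩
  have hqy : q • y ∈ Metric.closedBall (0 : Vec m) (q * R) := by
    rw [mem_closedBall_zero_iff] at hy ⊢
    rw [norm_smul, Real.norm_eq_abs, abs_of_pos hq0]
    nlinarith [norm_nonneg y]
  have h1 := hasDerivAt_comp_const_sub (hG.2.1 _ hmem _ hqy)
  have h2 : HasDerivAt (fun v => vec y * H v y) (vec y * Gamma (H u) y) u :=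
    (clMul m (vec y)).hasFDerivAt.comp_hasDerivAt u (hH.2.1 u hu y hy)
  have h3 : HasDerivAt (fun v => (q - 1) * Real.exp (-((m : ℝ) - 1) * v))
      ((q - 1) * (Real.exp (-((m : ℝ) - 1) * u) * (-((m : ℝ) - 1) * 1))) u :=
    (((hasDerivAt_id u).const_mul _).exp).const_mul _
  have d1 := analyticAt_slice (G := fun u y => G (Real.log q - u) (q • y))
    (analyticAt_reverseFlow_left hq0 hq1 hG hu hy)
  have d2 := analyticAt_slice (G := fun u y => vec y * H u y)
    (analyticAt_reverseFlow_right hH hu hy)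
  have d3 : DifferentiableAt ℝ (H u) y := (analyticAt_slice (hH.1 _ ⟨hu, hy⟩)).differentiableAt
  refine (h1.fun_sub (h3.smul h2)).congr_deriv ?_
  have e1 : Gamma (reverseFlow q G H u) y = Gamma (fun y => G (Real.log q - u) (q • y)) y
      - ((q - 1) * Real.exp (-((m : ℝ) - 1) * u)) • Gamma (fun y => vec y * H u y) y := by
    rw [← Gamma_const_smul _ d2.differentiableAt, ← Gamma_sub d1.differentiableAt
      (d2.differentiableAt.fun_const_smul _)]
    rfl
  rw [e1, Gamma_comp_smul, Gamma_vec_mul d3]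
  module

-- At time $0$ this is the definition of $\partial^q f$ solved for $f$, which explains the form of
-- `reverseFlow`. The origin is excluded since $\partial^q f$ is a limit there.
include hq1 hGq hH in
theorem reverseFlow_zero {y : Vec m} (hy0 : y ≠ 0) (hy : y ∈ Metric.closedBall 0 (q * R)) :
    reverseFlow q G H 0 y = f y := by
  have hq : q - 1 ≠ 0 := by linarith
  rw [reverseFlow, hH.2.2 y hy, qDirac_of_ne_zero hy0, ← mul_assoc, vec_mul_vecInv hy0, hGq]
  simp [smul_smul, hq]

-- At time $\ln q$ the first term of `reverseFlow` is $f(q\cdot)$, so its definition can be solved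
-- for $q^\Gamma\partial^q f$. Integer powers are used because $m-2$ is negative for $m=1$.
include hq0 hq1 hG hGq hHq in
theorem qLaplace_eq {x : Vec m} (hx0 : x ≠ 0) (hx : x ∈ Metric.closedBall 0 R) :
    qLaplace q R f x = ((q - 1) ^ 2 * ‖x‖ ^ 2)⁻¹ •
      (q ^ ((m : ℤ) - 2) • f (q • q • x) + f x - (G (Real.log q) (q • x)
        + q ^ ((m : ℤ) - 2) • reverseFlow q G H (Real.log q) (q • x))) := by
  have hq : q - 1 ≠ 0 := by linarith
  have hqx : q • x ≠ 0 := by simp [hq0.ne', hx0]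
  have hqqx : q • q • x ∈ Metric.closedBall (0 : Vec m) (q * R) := by
    rw [mem_closedBall_zero_iff] at hx ⊢
    rw [norm_smul, norm_smul, Real.norm_eq_abs, abs_of_pos hq0]
    have : q * ‖x‖ ≤ ‖x‖ := by nlinarith [norm_nonneg x]
    nlinarith [norm_nonneg x]
  have hexp : Real.exp (-((m : ℝ) - 1) * Real.log q) = (q ^ ((m : ℤ) - 1))⁻¹ := by
    rw [neg_mul, Real.exp_neg, mul_comm, ← Real.rpow_def_of_pos hq0, ← Real.rpow_intCast]
    push_cast
    rfl
  have hK : vec (q • x) * H (Real.log q) (q • x) = (q ^ ((m : ℤ) - 1) * (q - 1)⁻¹) •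
      (f (q • q • x) - reverseFlow q G H (Real.log q) (q • x)) := by
    rw [reverseFlow, sub_self, hG.2.2 _ hqqx, hexp, sub_sub_cancel, smul_smul]
    have : q ^ ((m : ℤ) - 1) * (q - 1)⁻¹ * ((q - 1) * (q ^ ((m : ℤ) - 1))⁻¹) = 1 := by
      field_simp
    rw [this, one_smul]
  have hH' : H (Real.log q) (q • x) = (q⁻¹ * (q ^ ((m : ℤ) - 1) * (q - 1)⁻¹)) • (vecInv x *
      (f (q • q • x) - reverseFlow q G H (Real.log q) (q • x))) := by
    have := congrArg (fun a => vecInv (q • x) * a) hK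
    rw [← mul_assoc, vecInv_mul_vec hqx, one_mul, vecInv_smul, smul_mul_smul_comm] at this
    exact this
  -- The drop from $m-1$ to $m-2$ comes from the inverse of the vector at $qx$.
  have hz : q⁻¹ * (q ^ ((m : ℤ) - 1) * (q - 1)⁻¹) = q ^ ((m : ℤ) - 2) * (q - 1)⁻¹ := by
    rw [← mul_assoc, ← zpow_neg_one, ← zpow_add₀ hq0.ne']
    congr 2
    ring
  rw [qLaplace, qDirac_of_ne_zero hx0, hHq, hH', hz, qDirac_of_ne_zero hx0, hGq]
  simp only [mul_smul_comm, mul_sub, smul_sub, ← mul_assoc, vecInv_mul_vecInv, neg_mul,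
    smul_mul_assoc, one_mul, smul_smul, smul_neg, mul_inv, smul_add, ← inv_pow]
  module

end

end QFlows

/-! ### Wave representation and boundedness of $\Delta_q f$ -/

section QLaplace

variable {m : ℕ} {q R : ℝ}

/-- With $c=(m-2)/2$, the wave is $W(u)=e^{u(\Gamma-c)}f+e^{-u(\Gamma-c)}f$, whose initial value is
$2f$. At $u=\ln q$, multiplication by $q^c$ gives $q^\Gamma f+q^{m-2}q^{-\Gamma}f$, the middle term
of `qLaplace_eq`. -/
theorem exists_wave (hq0 : 0 < q) (hq1 : q < 1) {f : Vec m → Cl m} (hf : QLaplaceDefined q R f) :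
    ∃ W Z : ℝ → Vec m → Cl m,
      (∀ r, 0 < r → r ≤ q * R →
        IsSphericalWave (Real.log q) r ((((m : ℝ) - 2) / 2) ^ 2) W Z) ∧
      (∀ y ∈ Metric.closedBall (0 : Vec m) (q * R), y ≠ 0 → W 0 y = (2 : ℝ) • f y) ∧
      ∀ x ∈ Metric.closedBall (0 : Vec m) R, x ≠ 0 →
        qLaplace q R f x = ((q - 1) ^ 2 * ‖x‖ ^ 2)⁻¹ • (q ^ ((m : ℤ) - 2) • f (q • q • x) + f x
          - Real.exp (((m : ℝ) - 2) / 2 * Real.log q) • W (Real.log q) (q • x)) := by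
  obtain ⟨G, hG, hGq⟩ := hf.1.exists_flow
  obtain ⟨H, hH, hHq⟩ := hf.2.exists_flow
  set c : ℝ := ((m : ℝ) - 2) / 2 with hc
  have hl : Real.log q ≤ 0 := (Real.log_neg hq0 hq1).le
  refine ⟨fun u x => Real.exp (-c * u) • G u x + Real.exp (c * u) • reverseFlow q G H u x,
    fun u x => Gamma (fun y => Real.exp (-c * u) • G u y - Real.exp (c * u) • reverseFlow q G H u y) x
      - c • (Real.exp (-c * u) • G u x - Real.exp (c * u) • reverseFlow q G H u x), ?_, ?_, ?_⟩
  · intro r hr hrq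
    have hball : ∀ x ∈ Metric.sphere (0 : Vec m) r, x ∈ Metric.closedBall (0 : Vec m) (q * R) :=
      fun x hx => Metric.closedBall_subset_closedBall hrq (Metric.sphere_subset_closedBall hx)
    refine isSphericalWave_of_flows (a := fun u x => Real.exp (-c * u) • G u x)
      (b := fun u x => Real.exp (c * u) • reverseFlow q G H u x) (by rw [hc]; ring) hl ?_ ?_ ?_ ?_ ?_
    · exact fun p hp => analyticAt_exp_smul (hG.1 p ⟨hp.1, hball _ hp.2⟩)
    · exact fun p hp => analyticAt_exp_smul (analyticAt_reverseFlow hq0 hq1 hG hH hp.1 (hball _ hp.2))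
    · intro u hu x hx
      have h := hasDerivAt_exp_smul_flow (κ := -c) (σ := 1)
        (analyticAt_slice (hG.1 (u, x) ⟨hu, hball x hx⟩)).differentiableAt
        (by rw [one_smul]; exact hG.2.1 u hu x (hball x hx))
      refine h.congr_deriv ?_
      module
    · intro u hu x hx
      have h := hasDerivAt_exp_smul_flow (κ := c) (σ := -1)
        (analyticAt_slice (analyticAt_reverseFlow hq0 hq1 hG hH hu (hball x hx))).differentiableAt
        (by rw [neg_one_smul]; exact hasDerivAt_reverseFlow hq0 hq1 hG hH hu (hball x hx))
      refine h.congr_deriv ?_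
      module
    · intro x hx
      have hx0 : x ≠ 0 := by
        rintro rfl
        rw [mem_sphere_zero_iff_norm, norm_zero] at hx
        exact hr.ne hx
      simp only [mul_zero, Real.exp_zero, one_smul]
      rw [reverseFlow_zero hq1 hGq hH hx0 (hball x hx), hG.2.2 x (hball x hx)]
  · intro y hy hy0
    simp only [mul_zero, Real.exp_zero, one_smul]
    rw [reverseFlow_zero hq1 hGq hH hy0 hy, hG.2.2 y hy, two_smul]
  · intro x hx hx0
    have e1 : Real.exp (c * Real.log q) * Real.exp (-c * Real.log q) = 1 := by
      rw [← Real.exp_add]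
      simp
    have e2 : Real.exp (c * Real.log q) * Real.exp (c * Real.log q) = q ^ ((m : ℤ) - 2) := by
      rw [← Real.exp_add, ← Real.rpow_intCast, Real.rpow_def_of_pos hq0]
      congr 1
      push_cast
      rw [hc]
      ring
    rw [qLaplace_eq hq0 hq1 hG hGq hHq hx0 hx, smul_add (Real.exp (c * Real.log q)),
      smul_smul (Real.exp (c * Real.log q)), smul_smul (Real.exp (c * Real.log q)), e1, e2,
      one_smul]

theorem continuousOn_vecInv : ContinuousOn (vecInv (m := m)) {0}ᶜ := by
  have : vecInv (m := m) = fun x => -((‖x‖ ^ 2)⁻¹ • vecL m x) := by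
    funext x
    rw [vecInv, vecL_apply]
  rw [this]
  have h1 : ContinuousOn (fun x : Vec m => (‖x‖ ^ 2)⁻¹) {0}ᶜ :=
    ContinuousOn.inv₀ (by fun_prop) fun x hx => by simpa using hx
  exact (h1.smul (vecL m).continuous.continuousOn).neg

/-- Continuity is assumed and obtained only off the origin, so that the lemma can be iterated to
reach $\Delta_q f$. -/
theorem continuousOn_qDirac (hq0 : 0 < q) {f : Vec m → Cl m}
    (hf : ContinuousOn f (Metric.closedBall 0 R \ {0})) (hD : QGammaDefined q (q * R) f)
    (hl : Real.log q ≤ 0) :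
    ContinuousOn (qDirac q R f) (Metric.closedBall 0 R \ {0}) := by
  obtain ⟨G, hG, hGq⟩ := hD.exists_flow
  have hcong : ∀ x ∈ Metric.closedBall (0 : Vec m) R \ {0}, qDirac q R f x =
      vecInv x * (q - 1)⁻¹ • (G (Real.log q) (q • x) - f x) := by
    intro x hx
    rw [qDirac_of_ne_zero (by simpa using hx.2), hGq]
  refine ContinuousOn.congr ?_ hcong
  have h1 : ContinuousOn (fun x : Vec m => G (Real.log q) (q • x)) (Metric.closedBall 0 R \ {0}) := by
    intro x hx
    have hqx : q • x ∈ Metric.closedBall (0 : Vec m) (q * R) := by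
      have := hx.1
      rw [mem_closedBall_zero_iff] at this ⊢
      rw [norm_smul, Real.norm_eq_abs, abs_of_pos hq0]
      gcongr
    have h := (analyticAt_slice (hG.1 (Real.log q, q • x) ⟨⟨le_rfl, hl⟩, hqx⟩)).continuousAt
    exact (ContinuousAt.comp (f := fun x : Vec m => q • x) h (by fun_prop)).continuousWithinAt
  exact continuous_clMul.comp_continuousOn
    ((continuousOn_vecInv.mono fun x hx => hx.2).prodMk ((h1.sub hf).const_smul (q - 1)⁻¹))

theorem norm_vecInv_le (x : Vec m) : ‖vecInv x‖ ≤ ‖vecL m‖ * ‖x‖⁻¹ := by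
  rcases eq_or_ne x 0 with rfl | hx
  · simp [vecInv]
  rw [vecInv, norm_neg, norm_smul, ← vecL_apply, norm_inv, norm_pow, norm_norm]
  calc (‖x‖ ^ 2)⁻¹ * ‖vecL m x‖ ≤ (‖x‖ ^ 2)⁻¹ * (‖vecL m‖ * ‖x‖) := by
        gcongr
        exact (vecL m).le_opNorm x
    _ = ‖vecL m‖ * ‖x‖⁻¹ := by
        have : ‖x‖ ≠ 0 := norm_ne_zero_iff.mpr hx
        field_simp

/-- The coefficients of $\Gamma$ vanish at the origin, so the flow is stationary there. -/
theorem flow_zero_const {ρ : ℝ} (hρ : 0 ≤ ρ) (hl : Real.log q ≤ 0) {f : Vec m → Cl m}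
    {G : ℝ → Vec m → Cl m} (hG : IsGammaFlow q ρ f G) : G (Real.log q) 0 = G 0 0 := by
  have hd : ∀ u ∈ Set.Icc (Real.log q) 0, HasDerivAt (fun v => G v 0) 0 u := by
    intro u hu
    refine (hG.2.1 u hu 0 (by simpa using hρ)).congr_deriv ?_
    simp [Gamma]
  have := intervalIntegral.integral_eq_sub_of_hasDerivAt (f := fun v => G v 0) (f' := fun _ => 0)
    (a := Real.log q) (b := 0) (fun u hu => hd u (by rwa [Set.uIcc_of_le hl] at hu))
    intervalIntegrable_const
  rw [intervalIntegral.integral_zero] at this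
  exact (sub_eq_zero.mp this.symm).symm

/-- With $H$ the flow of $\partial^q f$, the numerator $H(\ln q,qx)-H(0,x)$ is differentiable and
zero at the origin, hence $O(|x|)$, which compensates $|1/\underline{x}|=O(|x|^{-1})$. -/
theorem qLaplace_bounded_near_zero (hq0 : 0 < q) (hR : 0 < R) (hl : Real.log q ≤ 0)
    {f : Vec m → Cl m} (hf : QLaplaceDefined q R f) :
    ∃ C, ∀ᶠ x in 𝓝 (0 : Vec m), x ≠ 0 → ‖qLaplace q R f x‖ ≤ C := by
  obtain ⟨H, hH, hHq⟩ := hf.2.exists_flow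
  have hqR : 0 < q * R := mul_pos hq0 hR
  have h0 : (0 : Vec m) ∈ Metric.closedBall (0 : Vec m) (q * R) := by simpa using hqR.le
  have d1 : DifferentiableAt ℝ (H (Real.log q)) (q • (0 : Vec m)) := by
    rw [smul_zero]
    exact (analyticAt_slice (hH.1 (Real.log q, 0) ⟨⟨le_rfl, hl⟩, h0⟩)).differentiableAt
  have d2 : DifferentiableAt ℝ (H 0) (0 : Vec m) :=
    (analyticAt_slice (hH.1 (0, 0) ⟨⟨hl, le_rfl⟩, h0⟩)).differentiableAt
  have d3 : DifferentiableAt ℝ (fun x : Vec m => H (Real.log q) (q • x)) 0 :=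
    DifferentiableAt.comp (f := fun x : Vec m => q • x) 0 d1 (by fun_prop)
  have hO := (d3.fun_sub d2).isBigO_sub
  simp only [smul_zero, flow_zero_const hqR.le hl hH, sub_self, sub_zero] at hO
  obtain ⟨C, hC⟩ := hO.bound
  refine ⟨‖clMul m‖ * ‖vecL m‖ * (‖(q - 1)⁻¹‖ * C), ?_⟩
  filter_upwards [hC, Metric.closedBall_mem_nhds (0 : Vec m) hqR] with x hx hxb hx0
  have hpos : 0 < ‖x‖ := norm_pos_iff.mpr hx0
  rw [qLaplace, norm_neg, qDirac_of_ne_zero hx0, hHq, ← hH.2.2 x hxb, ← clMul_apply]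
  calc _ ≤ ‖clMul m‖ * ‖vecInv x‖ * ‖(q - 1)⁻¹ • (H (Real.log q) (q • x) - H 0 x)‖ :=
        (clMul m).le_opNorm₂ _ _
    _ ≤ ‖clMul m‖ * (‖vecL m‖ * ‖x‖⁻¹) * (‖(q - 1)⁻¹‖ * (C * ‖x‖)) := by
        rw [norm_smul]
        gcongr
        exact norm_vecInv_le x
    _ = _ := by
        field_simp

theorem qLaplace_bounded (hq0 : 0 < q) (hq1 : q < 1) (hR : 0 < R) {f : Vec m → Cl m}
    (hfc : ContinuousOn f (Metric.closedBall 0 R)) (hf : QLaplaceDefined q R f) :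
    ContinuousOn (qLaplace q R f) (Metric.closedBall 0 R \ {0}) ∧
      ∃ C, ∀ x ∈ Metric.closedBall (0 : Vec m) R \ {0}, ‖qLaplace q R f x‖ ≤ C := by
  have hl : Real.log q ≤ 0 := (Real.log_neg hq0 hq1).le
  have hc : ContinuousOn (qLaplace q R f) (Metric.closedBall 0 R \ {0}) :=
    (continuousOn_qDirac hq0 (continuousOn_qDirac hq0 (hfc.mono Set.sdiff_subset) hf.1 hl)
      hf.2 hl).neg
  refine ⟨hc, ?_⟩
  obtain ⟨C, hC⟩ := qLaplace_bounded_near_zero hq0 hR hl hf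
  obtain ⟨δ, hδ, hδC⟩ := Metric.eventually_nhds_iff.mp hC
  have hcomp : IsCompact (Metric.closedBall (0 : Vec m) R \ Metric.ball 0 δ) :=
    (isCompact_closedBall _ _).diff Metric.isOpen_ball
  obtain ⟨C', hC'⟩ := hcomp.exists_bound_of_continuousOn (hc.mono fun x hx =>
    ⟨hx.1, fun h => hx.2 (by rw [Set.mem_singleton_iff.mp h]; exact Metric.mem_ball_self hδ)⟩)
  refine ⟨max C C', fun x hx => ?_⟩
  by_cases hxδ : x ∈ Metric.ball 0 δ
  · exact (hδC hxδ (by simpa using hx.2)).trans (le_max_left _ _)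
  · exact (hC' x ⟨hx.1, hxδ⟩).trans (le_max_right _ _)

end QLaplace

/-! ### Convergence of the $q$-integral and integrals over small spheres -/

section QIntegral

variable {m : ℕ} {q R : ℝ}

/-- A bounded function that is continuous away from the origin is `q`-integrable, and its
`q`-integral is the series of the integrals over the spheres of radii `R q^k`. -/
theorem qIntegrable_of_bounded (hq0 : 0 < q) (hq1 : q < 1) (hR : 0 < R) {h : Vec m → Cl m}
    (hc : ContinuousOn h (Metric.closedBall 0 R \ {0})) {C : ℝ}
    (hC : ∀ x ∈ Metric.closedBall (0 : Vec m) R \ {0}, ‖h x‖ ≤ C) :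
    QIntegrable q R h ∧ ∃ S : Cl m, qIntegral q R h = ((1 - q) * R) • S ∧
      HasSum (fun k : ℕ => (q ^ k * (R * q ^ k) ^ (m - 1)) • sphereIntegral (R * q ^ k) h) S := by
  have hrpos : ∀ k : ℕ, 0 < R * q ^ k := fun k => by positivity
  have hrle : ∀ k : ℕ, R * q ^ k ≤ R := fun k =>
    mul_le_of_le_one_right hR.le (pow_le_one₀ hq0.le hq1.le)
  have hsub : ∀ k : ℕ, Metric.sphere (0 : Vec m) (R * q ^ k) ⊆ Metric.closedBall 0 R \ {0} := by
    intro k x hx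
    rw [mem_sphere_zero_iff_norm] at hx
    refine ⟨by rw [mem_closedBall_zero_iff, hx]; exact hrle k, fun h0 => ?_⟩
    rw [Set.mem_singleton_iff.mp h0, norm_zero] at hx
    exact (hrpos k).ne hx
  set φ : ℕ → Metric.sphere (0 : Vec m) 1 → Cl m := fun k ξ =>
    q ^ k • ((R * q ^ k) ^ (m - 1) • h ((R * q ^ k) • (ξ : Vec m))) with hφ
  have hφc : ∀ k, Continuous (φ k) := fun k =>
    ((continuous_smul_sphere (hrpos k).le (hc.mono (hsub k))).fun_const_smul _).fun_const_smul _
  have hφb : ∀ k ξ, ‖φ k ξ‖ ≤ q ^ k * (R ^ (m - 1) * C) := by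
    intro k ξ
    have hb := hC _ (hsub k (smul_mem_sphere (hrpos k).le ξ))
    have hC0 : 0 ≤ C := (norm_nonneg _).trans hb
    rw [hφ]
    simp only [norm_smul, norm_pow, Real.norm_eq_abs, abs_of_pos hq0, abs_of_pos (hrpos k)]
    gcongr
    exact hrle k
  have hsum : Summable fun k : ℕ => q ^ k * (R ^ (m - 1) * C) :=
    (summable_geometric_of_lt_one hq0.le hq1).mul_right _
  have hφs : ∀ ξ, Summable fun k => φ k ξ := fun ξ =>
    Summable.of_norm_bounded hsum fun k => hφb k ξ
  have htc : Continuous fun ξ => ∑' k, φ k ξ := continuous_tsum hφc hsum hφb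
  refine ⟨⟨hφs, integrable_sphere (htc.fun_const_smul ((1 - q) * R))⟩,
    ∫ ξ, ∑' k, φ k ξ ∂(volume : Measure (Vec m)).toSphere, integral_smul _ _, ?_⟩
  have hint := hasSum_integral_of_summable_integral_norm
    (μ := (volume : Measure (Vec m)).toSphere) (F := φ) (fun k => integrable_sphere (hφc k)) ?_
  · have e : (fun k : ℕ => (q ^ k * (R * q ^ k) ^ (m - 1)) • sphereIntegral (R * q ^ k) h) =
        fun k => ∫ ξ, φ k ξ ∂(volume : Measure (Vec m)).toSphere := by
      funext k
      rw [mul_smul]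
      simp only [hφ, integral_smul]
      rfl
    rw [e]
    exact hint
  · refine Summable.of_nonneg_of_le (fun k => integral_nonneg fun ξ => norm_nonneg _)
      (fun k => ?_) (hsum.mul_right ((volume : Measure (Vec m)).toSphere.real Set.univ))
    have := integral_mono (μ := (volume : Measure (Vec m)).toSphere)
      (integrable_sphere (hφc k).norm) (integrable_const _) (hφb k)
    rw [integral_const, smul_eq_mul, mul_comm] at this
    exact this

/-- The integral over a small sphere of a function that vanishes at the origin is of smaller order
than the radius, because the linear part of the function is odd. -/
theorem sphereIntegral_isLittleO {d : Vec m → Cl m} (hR : 0 < R)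
    (hc : ContinuousOn d (Metric.closedBall 0 R)) (hd : DifferentiableAt ℝ d 0) (h0 : d 0 = 0) :
    (fun r => sphereIntegral r d) =o[𝓝[>] 0] (fun r : ℝ => r) := by
  set M : ℝ := (volume : Measure (Vec m)).toSphere.real Set.univ with hM
  have hM0 : 0 ≤ M := measureReal_nonneg
  rw [Asymptotics.isLittleO_iff]
  intro ε hε
  have hlin : (fun x => d x - fderiv ℝ d 0 x) =o[𝓝 0] fun x : Vec m => x := by
    have := hd.hasFDerivAt.isLittleO
    simpa [h0] using this
  have hε' : 0 < ε / (M + 1) := by positivity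
  obtain ⟨δ, hδ, hδb⟩ := Metric.eventually_nhds_iff.mp (hlin.def hε')
  filter_upwards [Ioo_mem_nhdsGT (lt_min hδ hR)] with r hr
  have hrδ : r < δ := hr.2.trans_le (min_le_left _ _)
  have hrR : r ≤ R := hr.2.le.trans (min_le_right _ _)
  have hcr : ContinuousOn d (Metric.sphere 0 r) :=
    hc.mono (Metric.sphere_subset_closedBall.trans (Metric.closedBall_subset_closedBall hrR))
  have hcr' : ContinuousOn (fun x => d (-x)) (Metric.sphere 0 r) :=
    hcr.comp (by fun_prop) fun x hx => by simpa using hx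
  -- The antipodal map preserves the measure, and in $d(x)+d(-x)$ the derivative at the origin
  -- cancels.
  have hodd : (2 : ℝ) • sphereIntegral r d = sphereIntegral r (fun x => d x + d (-x)) := by
    rw [sphereIntegral_add hr.1.le hcr hcr', two_smul]
    congr 1
    exact (sphereIntegral_comp (LinearIsometryEquiv.neg ℝ) hr.1.le hcr).symm
  have hb : ∀ x ∈ Metric.sphere (0 : Vec m) r, ‖d x + d (-x)‖ ≤ 2 * (ε / (M + 1) * r) := by
    intro x hx
    rw [mem_sphere_zero_iff_norm] at hx
    have b1 := hδb (y := x) (by rw [dist_zero_right, hx]; exact hrδ)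
    have b2 := hδb (y := -x) (by rw [dist_zero_right, norm_neg, hx]; exact hrδ)
    rw [norm_neg, hx] at b2
    rw [hx] at b1
    calc ‖d x + d (-x)‖ = ‖(d x - fderiv ℝ d 0 x) + (d (-x) - fderiv ℝ d 0 (-x))‖ := by
          rw [map_neg]
          congr 1
          abel
      _ ≤ _ := (norm_add_le _ _).trans (by linarith)
  have hbound : ‖sphereIntegral r (fun x => d x + d (-x))‖ ≤ 2 * (ε / (M + 1) * r) * M :=
    norm_integral_le_of_norm_le_const (.of_forall fun ξ => hb _ (smul_mem_sphere hr.1.le ξ))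
  rw [← hodd, norm_smul, Real.norm_eq_abs, abs_two] at hbound
  rw [Real.norm_eq_abs, abs_of_pos hr.1]
  have hle : ε / (M + 1) * M ≤ ε := by
    rw [div_mul_eq_mul_div, div_le_iff₀ (by positivity)]
    nlinarith
  nlinarith [mul_le_mul_of_nonneg_right hle hr.1.le]

end QIntegral

/-! ### Green's formula and the boundary terms -/

section Green

variable {m : ℕ} {q R : ℝ}

theorem smul_mem_closedBall (hq0 : 0 ≤ q) {ρ : ℝ} {x : Vec m}
    (hx : x ∈ Metric.closedBall (0 : Vec m) ρ) : q • x ∈ Metric.closedBall (0 : Vec m) (q * ρ) := by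
  rw [mem_closedBall_zero_iff] at hx ⊢
  rw [norm_smul, Real.norm_eq_abs, abs_of_nonneg hq0]
  gcongr

theorem smul_mem_closedBall_self (hq0 : 0 ≤ q) (hq1 : q ≤ 1) {ρ : ℝ} {x : Vec m}
    (hx : x ∈ Metric.closedBall (0 : Vec m) ρ) : q • x ∈ Metric.closedBall (0 : Vec m) ρ := by
  have hρ : 0 ≤ ρ := (norm_nonneg x).trans (mem_closedBall_zero_iff.mp hx)
  exact Metric.closedBall_subset_closedBall (mul_le_of_le_one_left hρ hq1)
    (smul_mem_closedBall hq0 hx)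

theorem sphereIntegral_comp_smul (c r : ℝ) (φ : Vec m → Cl m) :
    sphereIntegral r (fun x => φ (c • x)) = sphereIntegral (c * r) φ := by
  simp only [sphereIntegral, smul_smul]

/-- If `g` and `∂^q g` vanish on the sphere of radius `R`, then `g` vanishes on the sphere of radius
`q R`. -/
theorem eq_zero_of_qDirac_eq_zero (hq0 : 0 < q) (hq1 : q < 1) (hR : 0 < R) {g : Vec m → Cl m}
    (hgD : QGammaDefined q (q * R) g) (hg0 : ∀ x ∈ Metric.sphere (0 : Vec m) R, g x = 0)
    (hDg0 : ∀ x ∈ Metric.sphere (0 : Vec m) R, qDirac q R g x = 0) :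
    ∀ x ∈ Metric.sphere (0 : Vec m) R, g (q • x) = 0 := by
  obtain ⟨G, hG, hGq⟩ := hgD.exists_flow
  have hqR : 0 < q * R := mul_pos hq0 hR
  have hl : Real.log q ≤ 0 := (Real.log_neg hq0 hq1).le
  have hball := Metric.sphere_subset_closedBall (x := (0 : Vec m)) (ε := q * R)
  -- Since $g$ and $\partial^q g$ vanish at $q^{-1}y$, the definition of $\partial^q g$ leaves
  -- $(q^\Gamma g)(y)=0$.
  have h1 : ∀ y ∈ Metric.sphere (0 : Vec m) (q * R), G (Real.log q) y = 0 := by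
    intro y hy
    have hx : q⁻¹ • y ∈ Metric.sphere (0 : Vec m) R := by
      rw [mem_sphere_zero_iff_norm] at hy ⊢
      rw [norm_smul, norm_inv, Real.norm_eq_abs, abs_of_pos hq0, hy]
      field_simp
    have hx0 : q⁻¹ • y ≠ 0 := by
      intro h
      rw [h, mem_sphere_zero_iff_norm, norm_zero] at hx
      exact hR.ne hx
    have h := congrArg (fun a => vec (q⁻¹ • y) * a) (hDg0 _ hx)
    have hq : (q - 1)⁻¹ ≠ 0 := inv_ne_zero (by linarith)
    rw [qDirac_of_ne_zero hx0, ← mul_assoc, vec_mul_vecInv hx0, one_mul, hg0 _ hx, sub_zero,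
      smul_inv_smul₀ hq0.ne', hGq, mul_zero] at h
    exact (smul_eq_zero.mp h).resolve_left hq
  intro x hx
  have hy : q • x ∈ Metric.sphere (0 : Vec m) (q * R) := by
    rw [mem_sphere_zero_iff_norm] at hx ⊢
    rw [norm_smul, Real.norm_eq_abs, abs_of_pos hq0, hx]
  rw [← hG.2.2 _ (hball hy)]
  exact flow_backward_unique hl hqR (fun p hp => hG.1 p ⟨hp.1, hball hp.2⟩)
    (fun u hu y hy => hG.2.1 u hu y (hball hy)) h1 _ hy

/-- Green's formula on one sphere. -/
theorem sphereIntegral_green (hq0 : 0 < q) (hq1 : q < 1) {f g : Vec m → Cl m}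
    (hf : ContinuousOn f (Metric.closedBall 0 R)) (hg : ContinuousOn g (Metric.closedBall 0 R))
    (hfD : QLaplaceDefined q R f) (hgD : QLaplaceDefined q R g) {r : ℝ} (hr : 0 < r) (hrR : r ≤ R) :
    sphereIntegral r (fun x => f (q • x) * qLaplace q R g x)
        - sphereIntegral r (fun x => qLaplace q R f x * g (q • x)) =
      ((q - 1) ^ 2 * r ^ 2)⁻¹ • (q ^ ((m : ℤ) - 2) •
          sphereIntegral (q * r) (fun x => f x * g (q • x) - f (q • x) * g x)
        - sphereIntegral r (fun x => f x * g (q • x) - f (q • x) * g x)) := by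
  obtain ⟨W, Z, hW, hW0, hWL⟩ := exists_wave hq0 hq1 hfD
  obtain ⟨W', Z', hW', hW'0, hW'L⟩ := exists_wave hq0 hq1 hgD
  have hl : Real.log q ≤ 0 := (Real.log_neg hq0 hq1).le
  have hqr : 0 < q * r := mul_pos hq0 hr
  have hqrR : q * r ≤ q * R := by gcongr
  have hw := hW _ hqr hqrR
  have hw' := hW' _ hqr hqrR
  have hne : ∀ {ρ : ℝ}, 0 < ρ → ∀ x ∈ Metric.sphere (0 : Vec m) ρ, x ≠ 0 := by
    rintro ρ hρ x hx rfl
    rw [mem_sphere_zero_iff_norm, norm_zero] at hx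
    exact hρ.ne hx
  have hball : ∀ x ∈ Metric.sphere (0 : Vec m) r, x ∈ Metric.closedBall (0 : Vec m) R :=
    fun x hx => Metric.closedBall_subset_closedBall hrR (Metric.sphere_subset_closedBall hx)
  have hball' : ∀ x ∈ Metric.sphere (0 : Vec m) (q * r), x ∈ Metric.closedBall (0 : Vec m) (q * R) :=
    fun x hx => Metric.closedBall_subset_closedBall hqrR (Metric.sphere_subset_closedBall hx)
  have hsph : ∀ x ∈ Metric.sphere (0 : Vec m) r, q • x ∈ Metric.sphere (0 : Vec m) (q * r) := by
    intro x hx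
    rw [mem_sphere_zero_iff_norm] at hx ⊢
    rw [norm_smul, Real.norm_eq_abs, abs_of_pos hq0, hx]
  have hwl : ∀ {W Z : ℝ → Vec m → Cl m}, IsSphericalWave (Real.log q) (q * r)
      ((((m : ℝ) - 2) / 2) ^ 2) W Z → ContinuousOn (W (Real.log q)) (Metric.sphere 0 (q * r)) :=
    fun h x hx => (analyticAt_slice
      (h.analytic_left (Real.log q, x) ⟨⟨le_rfl, hl⟩, hx⟩)).continuousAt.continuousWithinAt
  have hscale : ∀ {φ : Vec m → Cl m}, ContinuousOn φ (Metric.sphere 0 (q * r)) →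
      ContinuousOn (fun x => φ (q • x)) (Metric.sphere 0 r) := fun h =>
    h.comp (by fun_prop) hsph
  have hmul : ∀ {φ ψ : Vec m → Cl m}, ContinuousOn φ (Metric.sphere 0 r) →
      ContinuousOn ψ (Metric.sphere 0 r) → ContinuousOn (fun x => φ x * ψ x) (Metric.sphere 0 r) :=
    fun h1 h2 => continuous_clMul.comp_continuousOn (h1.prodMk h2)
  have hbq : ∀ {φ : Vec m → Cl m}, ContinuousOn φ (Metric.closedBall 0 R) →
      ContinuousOn φ (Metric.sphere 0 r) ∧ ContinuousOn (fun x => φ (q • x)) (Metric.sphere 0 r) ∧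
      ContinuousOn (fun x => φ (q • q • x)) (Metric.sphere 0 r) := fun h =>
    ⟨h.mono hball,
      h.comp (by fun_prop) fun x hx => smul_mem_closedBall_self hq0.le hq1.le (hball x hx),
      h.comp (by fun_prop) fun x hx => smul_mem_closedBall_self hq0.le hq1.le
        (smul_mem_closedBall_self hq0.le hq1.le (hball x hx))⟩
  obtain ⟨f0, f1, f2⟩ := hbq hf
  obtain ⟨g0, g1, g2⟩ := hbq hg
  have w1 := hscale (hwl hw)
  have w1' := hscale (hwl hw')
  -- Symmetry of the wave solution operator on the sphere of radius $qr$; the factor 2 is the one in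
  -- $W(0)=2f$, $W'(0)=2g$.
  have hmid : sphereIntegral r (fun x => f (q • x) * W' (Real.log q) (q • x)) =
      sphereIntegral r (fun x => W (Real.log q) (q • x) * g (q • x)) := by
    have h := hw.sphereIntegral_eq hl hqr.le hw'
    rw [sphereIntegral_congr hqr.le (ψ := fun x => (2 : ℝ) • (f x * W' (Real.log q) x))
      (fun x hx => by rw [hW0 x (hball' x hx) (hne hqr x hx), smul_mul_assoc]),
      sphereIntegral_congr (φ := fun x => W (Real.log q) x * W' 0 x) hqr.le
        (ψ := fun x => (2 : ℝ) • (W (Real.log q) x * g x))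
      (fun x hx => by rw [hW'0 x (hball' x hx) (hne hqr x hx), mul_smul_comm]),
      sphereIntegral_smul, sphereIntegral_smul] at h
    rw [sphereIntegral_comp_smul q r (fun x => f x * W' (Real.log q) x),
      sphereIntegral_comp_smul q r (fun x => W (Real.log q) x * g x)]
    exact smul_right_injective _ (two_ne_zero (α := ℝ)) h
  set s : ℝ := q ^ ((m : ℤ) - 2)
  set t : ℝ := Real.exp (((m : ℝ) - 2) / 2 * Real.log q)
  set κ : ℝ := ((q - 1) ^ 2 * r ^ 2)⁻¹
  have cL : ContinuousOn (fun x => f (q • x) * qLaplace q R g x) (Metric.sphere 0 r) := by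
    refine hmul f1 ((((g2.const_smul s).add g0).sub (w1'.const_smul t)).const_smul κ |>.congr ?_)
    intro x hx
    rw [hW'L x (hball x hx) (hne hr x hx), mem_sphere_zero_iff_norm.mp hx]
    rfl
  have cR : ContinuousOn (fun x => qLaplace q R f x * g (q • x)) (Metric.sphere 0 r) := by
    refine hmul ((((f2.const_smul s).add f0).sub (w1.const_smul t)).const_smul κ |>.congr ?_) g1
    intro x hx
    rw [hWL x (hball x hx) (hne hr x hx), mem_sphere_zero_iff_norm.mp hx]
    rfl
  -- The first bracket is the second evaluated at $qx$, hence its integral lives on the sphere of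
  -- radius $qr$; the third integrates to zero by `hmid`.
  have key : ∀ x ∈ Metric.sphere (0 : Vec m) r,
      f (q • x) * qLaplace q R g x - qLaplace q R f x * g (q • x) =
      κ • ((s • (f (q • x) * g (q • q • x) - f (q • q • x) * g (q • x))
        - (f x * g (q • x) - f (q • x) * g x))
        - t • (f (q • x) * W' (Real.log q) (q • x) - W (Real.log q) (q • x) * g (q • x))) := by
    intro x hx
    rw [hW'L x (hball x hx) (hne hr x hx), hWL x (hball x hx) (hne hr x hx),
      mem_sphere_zero_iff_norm.mp hx]
    simp only [mul_smul_comm, smul_mul_assoc, mul_add, mul_sub, add_mul, sub_mul]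
    module
  have c1 : ContinuousOn (fun x => f (q • x) * g (q • q • x) - f (q • q • x) * g (q • x))
      (Metric.sphere 0 r) := (hmul f1 g2).sub (hmul f2 g1)
  have c2 : ContinuousOn (fun x => f x * g (q • x) - f (q • x) * g x) (Metric.sphere 0 r) :=
    (hmul f0 g1).sub (hmul f1 g0)
  have c3 := hmul f1 w1'
  have c4 := hmul w1 g1
  rw [← sphereIntegral_sub hr.le cL cR, sphereIntegral_congr hr.le key, sphereIntegral_smul,
    sphereIntegral_sub hr.le ((c1.fun_const_smul s).fun_sub c2)
      ((c3.fun_sub c4).fun_const_smul t),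
    sphereIntegral_sub hr.le (c1.fun_const_smul s) c2, sphereIntegral_smul, sphereIntegral_smul,
    sphereIntegral_sub hr.le c3 c4, hmid, sub_self, smul_zero, sub_zero,
    sphereIntegral_comp_smul q r (fun x => f x * g (q • x) - f (q • x) * g x)]

/-- The boundary terms at the origin tend to zero. -/
theorem tendsto_boundary_term (hm : 1 ≤ m) (hq0 : 0 < q) (hq1 : q < 1) (hR : 0 < R)
    {d : Vec m → Cl m} (hc : ContinuousOn d (Metric.closedBall 0 R))
    (hd : DifferentiableAt ℝ d 0) (h0 : d 0 = 0) :
    Tendsto (fun k : ℕ => (q ^ ((m : ℤ) - 2)) ^ k • sphereIntegral (R * q ^ k) d) atTop (𝓝 0) := by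
  have hlim : Tendsto (fun k : ℕ => R * q ^ k) atTop (𝓝[>] 0) := by
    refine tendsto_nhdsWithin_iff.mpr ⟨?_, .of_forall fun k => by
      simp only [Set.mem_Ioi]; positivity⟩
    simpa using (tendsto_pow_atTop_nhds_zero_of_lt_one hq0.le hq1).const_mul R
  have ho := (sphereIntegral_isLittleO hR hc hd h0).comp_tendsto hlim
  rw [Metric.tendsto_nhds]
  intro ε hε
  filter_upwards [ho.def (c := ε / (2 * R)) (by positivity)] with k hk
  have hk' : ‖sphereIntegral (R * q ^ k) d‖ ≤ ε / (2 * R) * (R * q ^ k) := by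
    have : ‖R * q ^ k‖ = R * q ^ k := Real.norm_of_nonneg (by positivity)
    simpa only [Function.comp_apply, this] using hk
  -- The weight $q^{(m-2)k}$ is at most $q^{-k}$, with equality for $m=1$. A bound $O(r)$ on the
  -- sphere integral would not suffice in that case, so the $o(r)$ estimate is needed.
  have hs : (q ^ ((m : ℤ) - 2)) ^ k * q ^ k ≤ 1 := by
    rw [← mul_pow]
    refine pow_le_one₀ (by positivity) ?_
    rw [← zpow_add_one₀ hq0.ne']
    have : (m : ℤ) - 2 + 1 = ((m - 1 : ℕ) : ℤ) := by omega
    rw [this, zpow_natCast]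
    exact pow_le_one₀ hq0.le hq1.le
  rw [dist_zero_right, norm_smul, Real.norm_of_nonneg (by positivity)]
  calc (q ^ ((m : ℤ) - 2)) ^ k * ‖sphereIntegral (R * q ^ k) d‖
      ≤ (q ^ ((m : ℤ) - 2)) ^ k * (ε / (2 * R) * (R * q ^ k)) := by gcongr
    _ = ε / 2 * ((q ^ ((m : ℤ) - 2)) ^ k * q ^ k) := by field_simp
    _ ≤ ε / 2 * 1 := by gcongr
    _ < ε := by linarith

theorem bounded_mul {h₁ h₂ : Vec m → Cl m} {s : Set (Vec m)}
    (hb₁ : ∃ C, ∀ x ∈ s, ‖h₁ x‖ ≤ C) (hb₂ : ∃ C, ∀ x ∈ s, ‖h₂ x‖ ≤ C) :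
    ∃ C, ∀ x ∈ s, ‖h₁ x * h₂ x‖ ≤ C := by
  obtain ⟨C₁, h1⟩ := hb₁
  obtain ⟨C₂, h2⟩ := hb₂
  refine ⟨‖clMul m‖ * C₁ * C₂, fun x hx => ?_⟩
  have hC : 0 ≤ C₁ := (norm_nonneg _).trans (h1 x hx)
  refine ((clMul m).le_opNorm₂ (h₁ x) (h₂ x)).trans ?_
  gcongr
  · exact h1 x hx
  · exact h2 x hx

end Green

end QClifford

/-! ### The symmetry of $\Delta_q$: summation over the spheres -/

theorem mainTheorem10 (m : ℕ) (hm : 1 ≤ m) (q : ℝ) (hq0 : 0 < q) (hq1 : q < 1)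
    (R : ℝ) (hR : 0 < R)
    (f g : QClifford.Vec m → QClifford.Cl m)
    (hf : AnalyticOnNhd ℝ f (Metric.closedBall 0 R))
    (hg : AnalyticOnNhd ℝ g (Metric.closedBall 0 R))
    (hfD : QClifford.QLaplaceDefined q R f)
    (hgD : QClifford.QLaplaceDefined q R g)
    (hg0 : ∀ x ∈ Metric.sphere (0 : QClifford.Vec m) R, g x = 0)
    (hDg0 : ∀ x ∈ Metric.sphere (0 : QClifford.Vec m) R, QClifford.qDirac q R g x = 0) :
    QClifford.QIntegrable q R (fun x => f (q • x) * QClifford.qLaplace q R g x) ∧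
    QClifford.QIntegrable q R (fun x => QClifford.qLaplace q R f x * g (q • x)) ∧
    QClifford.qIntegral q R (fun x => f (q • x) * QClifford.qLaplace q R g x) =
      QClifford.qIntegral q R (fun x => QClifford.qLaplace q R f x * g (q • x)) := by
  open QClifford Filter Topology in
  have hqb : ∀ x ∈ Metric.closedBall (0 : Vec m) R, q • x ∈ Metric.closedBall (0 : Vec m) R :=
    fun x hx => smul_mem_closedBall_self hq0.le hq1.le hx
  have hscale : ∀ {φ : Vec m → Cl m}, ContinuousOn φ (Metric.closedBall 0 R) →
      ContinuousOn (fun x => φ (q • x)) (Metric.closedBall 0 R) := fun h =>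
    h.comp (by fun_prop) hqb
  have hbd : ∀ {φ : Vec m → Cl m}, ContinuousOn φ (Metric.closedBall 0 R) →
      ∃ C, ∀ x ∈ Metric.closedBall (0 : Vec m) R \ {0}, ‖φ x‖ ≤ C := fun h => by
    obtain ⟨C, hC⟩ := (isCompact_closedBall (0 : Vec m) R).exists_bound_of_continuousOn h
    exact ⟨C, fun x hx => hC x hx.1⟩
  have hfc := hf.continuousOn
  have hgc := hg.continuousOn
  obtain ⟨lfc, lfb⟩ := qLaplace_bounded hq0 hq1 hR hfc hfD
  obtain ⟨lgc, lgb⟩ := qLaplace_bounded hq0 hq1 hR hgc hgD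
  obtain ⟨C₁, hC₁⟩ := bounded_mul (hbd (hscale hfc)) lgb
  obtain ⟨C₂, hC₂⟩ := bounded_mul lfb (hbd (hscale hgc))
  obtain ⟨hi₁, S₁, hS₁, hsum₁⟩ := qIntegrable_of_bounded hq0 hq1 hR
    (continuous_clMul.comp_continuousOn (((hscale hfc).mono Set.sdiff_subset).prodMk lgc)) hC₁
  obtain ⟨hi₂, S₂, hS₂, hsum₂⟩ := qIntegrable_of_bounded hq0 hq1 hR
    (continuous_clMul.comp_continuousOn (lfc.prodMk ((hscale hgc).mono Set.sdiff_subset))) hC₂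
  refine ⟨hi₁, hi₂, hS₁.trans (Eq.trans ?_ hS₂.symm)⟩
  congr 1
  set d : Vec m → Cl m := fun x => f x * g (q • x) - f (q • x) * g x with hd
  set J : ℕ → Cl m := fun k => (q ^ ((m : ℤ) - 2)) ^ k • sphereIntegral (R * q ^ k) d with hJ
  have hterm : ∀ k : ℕ, (q ^ k * (R * q ^ k) ^ (m - 1)) •
        sphereIntegral (R * q ^ k) (fun x => f (q • x) * qLaplace q R g x)
      - (q ^ k * (R * q ^ k) ^ (m - 1)) •
        sphereIntegral (R * q ^ k) (fun x => qLaplace q R f x * g (q • x)) =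
      (((q - 1) ^ 2)⁻¹ * R ^ ((m : ℤ) - 3)) • (J (k + 1) - J k) := by
    intro k
    have hr : 0 < R * q ^ k := by positivity
    -- The exponents of $q^k$ add up to $1+(m-1)-2=m-2$, the same power as in Green's formula; this
    -- match makes the series telescope.
    have hw : q ^ k * (R * q ^ k) ^ (m - 1) * ((q - 1) ^ 2 * (R * q ^ k) ^ 2)⁻¹ =
        ((q - 1) ^ 2)⁻¹ * R ^ ((m : ℤ) - 3) * (q ^ ((m : ℤ) - 2)) ^ k := by
      obtain ⟨n, rfl⟩ : ∃ n, m = n + 1 := ⟨m - 1, by omega⟩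
      have e1 : R ^ (((n + 1 : ℕ) : ℤ) - 3) = R ^ n * (R ^ 2)⁻¹ := by
        rw [← zpow_natCast, ← zpow_natCast, ← zpow_neg, ← zpow_add₀ hR.ne']
        congr 1
        push_cast
        ring
      have e2 : q ^ (((n + 1 : ℕ) : ℤ) - 2) = q ^ n * q⁻¹ := by
        rw [← zpow_natCast, ← zpow_neg_one, ← zpow_add₀ hq0.ne']
        congr 1
        push_cast
        ring
      rw [e1, e2, Nat.add_sub_cancel]
      have hqk : q ^ k ≠ 0 := by positivity
      have hq : (q - 1) ^ 2 ≠ 0 := pow_ne_zero _ (by linarith)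
      rw [mul_pow (q ^ n), inv_pow, mul_pow R, ← pow_mul q n k, mul_comm n k, pow_mul]
      field_simp
    rw [← smul_sub, sphereIntegral_green hq0 hq1 hfc hgc hfD hgD hr
      (mul_le_of_le_one_right hR.le (pow_le_one₀ hq0.le hq1.le)), smul_smul, hw, mul_smul, hJ]
    congr 1
    rw [smul_sub, smul_smul, ← pow_succ, show q * (R * q ^ k) = R * q ^ (k + 1) by ring]
  have hJ0 : J 0 = 0 := by
    simp only [hJ, pow_zero, one_smul, mul_one]
    rw [sphereIntegral_congr hR.le (ψ := fun _ => 0), sphereIntegral, MeasureTheory.integral_zero]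
    intro x hx
    simp only [hd]
    rw [hg0 x hx, eq_zero_of_qDirac_eq_zero hq0 hq1 hR hgD.1 hg0 hDg0 x hx, mul_zero, mul_zero,
      sub_zero]
  have h0 : (0 : Vec m) ∈ Metric.closedBall (0 : Vec m) R := by simpa using hR.le
  have han : ∀ {φ : Vec m → Cl m}, AnalyticAt ℝ φ 0 → AnalyticAt ℝ (fun x => φ (q • x)) 0 :=
    fun h => AnalyticAt.fun_comp (f := fun x : Vec m => q • x) (by simpa using h)
      (analyticAt_const.fun_smul analyticAt_id)
  have hdan : AnalyticAt ℝ d 0 := (analyticAt_mul (hf 0 h0) (han (hg 0 h0))).fun_sub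
    (analyticAt_mul (han (hf 0 h0)) (hg 0 h0))
  have hdc : ContinuousOn d (Metric.closedBall 0 R) :=
    (continuous_clMul.comp_continuousOn (hfc.prodMk (hscale hgc))).sub
      (continuous_clMul.comp_continuousOn ((hscale hfc).prodMk hgc))
  have hJlim : Tendsto J atTop (𝓝 0) :=
    tendsto_boundary_term hm hq0 hq1 hR hdc hdan.differentiableAt (by simp [hd])
  -- The partial sums tend to `S₁ - S₂`; telescoped, they are a fixed multiple of `J n`, which tends
  -- to zero.
  have hdiff := (hsum₁.sub hsum₂).tendsto_sum_nat.congr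
    fun n => Finset.sum_congr rfl fun k _ => hterm k
  simp only [← Finset.smul_sum, Finset.sum_range_sub, hJ0, sub_zero] at hdiff
  have hlim := hJlim.const_smul (((q - 1) ^ 2)⁻¹ * R ^ ((m : ℤ) - 3))
  rw [smul_zero] at hlim
  exact sub_eq_zero.mp (tendsto_nhds_unique hdiff hlim)
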